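/- Let $V,E$ be finite sets and let $G=(V,E,\ell)$ be a compact metric graph: it arises from a nonempty, finite, connected multigraph $(V,E)$ (loops and multiple edges allowed) with edge lengths $\ell(e)\in(0,\infty)$ by taking an interval $[0,\ell(e)]$ for each edge $e$ and gluing end points according to the graph. Let $H^1(G)$ be the space of continuous $f\colon G\to\mathbb R$ whose restriction to each edge $e$ lies in $H^1((0,\ell(e)))$, and let $q(f,g)=\sum_{e\in E}\int_0^{\ell(e)}f'g'\,dx$, with weak derivatives. For a Borel probability measure $\mu$ on $G$, let $H^1(G,\mu)$ be the set of $f\in H^1(G)$ that are harmonic on $G\setminus\operatorname{supp}\mu$, i.e. $q(f,g)=0$ for all $g\in H^1(G)$ with $g=0$ on $\operatorname{supp}\mu$; it embeds into $L^2(G,\mu)$. Let $H_\mu$ be the self-adjoint operator in $L^2(G,\mu)$ with $f\in\operatorname{dom}(H_\mu)$ and $H_\mu f=h$ if and only if $f\in H^1(G,\mu)$ and $q(f,\varphi)=\int_G h\varphi\,d\mu$ for all $\varphi\in H^1(G,\mu)$. Let $0=\lambda_0(H_\mu)<\lambda_1(H_\mu)\le\lambda_2(H_\mu)\le\dots$ be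 its eigenvalues, counted with multiplicity, where $\lambda_k(H_\mu):=\infty$ if $k\ge\dim L^2(G,\mu)$, and let $$\lambda_1^{\min}(G)=\inf_\mu\lambda_1(H_\mu)\in[0,\infty],$$ the infimum being over all Borel probability measures $\mu$ on $G$. For $x,y\in G$ let $r(x,y)=f(x)$ be the effective resistance, where $f\in H^1(G)$ is the unique solution of $q(f,g)=g(x)-g(y)$ for all $g\in H^1(G)$ and $f(y)=0$. Let $\operatorname{diam}_r(G)=\sup_{x,y\in G}r(x,y)$, let $\varrho(x,y)$ be the path metric (the length of a shortest path from $x$ to $y$) and let $\operatorname{diam}_\varrho(G)=\sup_{x,y\in G}\varrho(x,y)$. **Theorem.** The supremum $\operatorname{diam}_r(G)$ is attained, it is positive if $E\ne\emptyset$, and $$\lambda_1^{\min}(G)=\frac{4}{\operatorname{diam}_r(G)}$$ (with $4/0=\infty$ if $G$ is a single point). A Borel probability measure $\mu$ on $G$ satisfies $\lambda_1(H_\mu)=\lambda_1^{\min}(G)$ if and only if $\mu=\mu_{x,y}:=\tfrac12(\delta_x+\delta_y)$ for some $x,y\in G$ with $r(x,y)=\operatorname{diam}_r(G)$; in particular,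 the infimum is a minimum. If $G$ is a tree, then moreover $\operatorname{diam}_\varrho(G)$ is attained and $$\lambda_1^{\min}(G)=\frac{4}{\operatorname{diam}_r(G)}=\frac{4}{\operatorname{diam}_\varrho(G)}.$$ -/

import Mathlib

open MeasureTheory Set Topology
open scoped ENNReal NNReal ContDiff

noncomputable section

/-! ### Sobolev functions of one variable -/

/-- `v` is a weak (distributional) derivative of `u` on the open interval `(a, b)`. -/
def IsWeakDerivOn (a b : ℝ) (u v : ℝ → ℝ) : Prop :=
  ∀ φ : ℝ → ℝ, ContDiff ℝ ∞ φ → HasCompactSupport φ → tsupport φ ⊆ Ioo a b →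
    ∫ x in Ioo a b, u x * deriv φ x = -∫ x in Ioo a b, v x * φ x

/-- `v` is a square integrable weak derivative of `u` on `(a, b)`. -/
def IsL2WeakDerivOn (a b : ℝ) (u v : ℝ → ℝ) : Prop :=
  MemLp v 2 (volume.restrict (Ioo a b)) ∧ IsWeakDerivOn a b u v

/-- `u` belongs to the Sobolev space `H¹((a, b))`. -/
def MemSobolevInterval (a b : ℝ) (u : ℝ → ℝ) : Prop :=
  MemLp u 2 (volume.restrict (Ioo a b)) ∧ ∃ v, IsL2WeakDerivOn a b u v

open Classical in
/-- The weak derivative of a function in `H¹((a, b))`, which is unique up to equality almost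
everywhere on `(a, b)`. -/
def weakDerivOn (a b : ℝ) (u : ℝ → ℝ) : ℝ → ℝ :=
  if h : ∃ v, IsL2WeakDerivOn a b u v then h.choose else 0

/-! ### Metric graphs -/

/-- A model of a metric graph: a nonempty connected multigraph (loops and multiple edges are
allowed) with vertices `V` and edges `E`, an arbitrary orientation of each edge, and a positive
length for each edge. Both `V` and `E` are assumed finite wherever this structure is used. -/
structure MetricGraph (V E : Type*) where
  src : E → V
  tgt : E → V
  len : E → ℝ
  len_pos : ∀ e, 0 < len e
  nonempty : Nonempty V
  connected : ∀ u v : V, Relation.EqvGen (fun a b => ∃ e, src e = a ∧ tgt e = b) u v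

namespace MetricGraph

variable {V E : Type*}

/-- The disjoint union of the vertices and of one closed interval `[0, ℓ(e)]` for each edge. -/
abbrev Pieces (G : MetricGraph V E) : Type _ :=
  V ⊕ (Σ e : E, Icc (0 : ℝ) (G.len e))

/-- The identification of the left and right end points of the interval of an edge with the
initial and the terminal vertex of that edge. -/
inductive Glue (G : MetricGraph V E) : G.Pieces → G.Pieces → Prop
  | left (e : E) : Glue G (Sum.inr ⟨e, ⟨0, left_mem_Icc.2 (G.len_pos e).le⟩⟩) (Sum.inl (G.src e))
  | right (e : E) :
      Glue G (Sum.inr ⟨e, ⟨G.len e, right_mem_Icc.2 (G.len_pos e).le⟩⟩) (Sum.inl (G.tgt e))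

/-- The metric graph as a space: the quotient of the disjoint union of its pieces. -/
def Point (G : MetricGraph V E) : Type _ := Quot G.Glue

/-- The quotient topology, where the vertices carry the discrete topology and the intervals their
usual one. -/
instance instTopologicalSpacePoint (G : MetricGraph V E) : TopologicalSpace G.Point :=
  letI : TopologicalSpace V := ⊥
  TopologicalSpace.coinduced (Quot.mk G.Glue) inferInstance

instance instMeasurableSpacePoint (G : MetricGraph V E) : MeasurableSpace G.Point := borel _

instance instBorelSpacePoint (G : MetricGraph V E) : BorelSpace G.Point := ⟨rfl⟩

/-- The point at position `t` of the edge `e`. -/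
def edgePoint (G : MetricGraph V E) (e : E) (t : Icc (0 : ℝ) (G.len e)) : G.Point :=
  Quot.mk G.Glue (Sum.inr ⟨e, t⟩)

/-! ### The path metric -/

/-- `G.HasPath x y c`: there is a path of arc length `c` from `x` to `y`, made of finitely many
segments, each of which runs inside one edge. -/
inductive HasPath (G : MetricGraph V E) : G.Point → G.Point → ℝ → Prop
  | nil (x : G.Point) : HasPath G x x 0
  | cons (e : E) (s t : Icc (0 : ℝ) (G.len e)) {y : G.Point} {c : ℝ} :
      HasPath G (G.edgePoint e t) y c →
        HasPath G (G.edgePoint e s) y (|(s : ℝ) - (t : ℝ)| + c)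

/-- The path metric `ϱ`. -/
def pathDist (G : MetricGraph V E) (x y : G.Point) : ℝ := sInf {c | G.HasPath x y c}

/-- The diameter of the metric graph in the path metric. -/
def pathDiam (G : MetricGraph V E) : ℝ :=
  sSup (range fun p : G.Point × G.Point => G.pathDist p.1 p.2)

/-! ### Trees -/

/-- `G.IsWalk u v es`: the list `es` consists of the successive edges of a walk from `u` to `v`,
where edges may be traversed in both directions. -/
inductive IsWalk (G : MetricGraph V E) : V → V → List E → Prop
  | nil (v : V) : IsWalk G v v []
  | cons {u v w : V} {es : List E} (e : E)
      (he : (G.src e = u ∧ G.tgt e = v) ∨ (G.src e = v ∧ G.tgt e = u)) :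
      IsWalk G v w es → IsWalk G u w (e :: es)

/-- The (connected) graph is a tree: it has no closed walk of positive length that uses each edge
at most once. -/
def IsTree (G : MetricGraph V E) : Prop :=
  ∀ (v : V) (es : List E), G.IsWalk v v es → es.Nodup → es = []

/-! ### The Sobolev space and the energy form -/

/-- The restriction of `f` to the edge `e`, as a function on `[0, ℓ(e)]` (extended to `ℝ` by its
values at the end points). -/
def onEdge (G : MetricGraph V E) (f : G.Point → ℝ) (e : E) : ℝ → ℝ :=
  IccExtend (G.len_pos e).le fun t => f (G.edgePoint e t)

/-- Membership in the Sobolev space `H¹(G)`. -/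
def MemH1 (G : MetricGraph V E) (f : G.Point → ℝ) : Prop :=
  Continuous f ∧ ∀ e, MemSobolevInterval 0 (G.len e) (G.onEdge f e)

/-- The energy form `q(f, g) = ∫_G f' g' dx`. -/
def energy [Fintype E] (G : MetricGraph V E) (f g : G.Point → ℝ) : ℝ :=
  ∑ e, ∫ x in Ioo 0 (G.len e),
    weakDerivOn 0 (G.len e) (G.onEdge f e) x * weakDerivOn 0 (G.len e) (G.onEdge g e) x

/-- `f` is harmonic on the set `O`. -/
def IsHarmonicOn [Fintype E] (G : MetricGraph V E) (f : G.Point → ℝ) (O : Set G.Point) : Prop :=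
  G.MemH1 f ∧ ∀ g, G.MemH1 g → (∀ x ∈ Oᶜ, g x = 0) → G.energy f g = 0

/-! ### The Laplacian of a measure and its eigenvalues -/

/-- Membership in `H¹(G, μ)`: functions in `H¹(G)` that are harmonic off the support of `μ`. Each
of them is determined by its class in `L²(G, μ)`. -/
def MemH1Measure [Fintype E] (G : MetricGraph V E) (μ : Measure G.Point) (f : G.Point → ℝ) :
    Prop :=
  G.IsHarmonicOn f μ.supportᶜ

/-- The graph of the operator `H_μ` on `L²(G, μ)` generated by the energy form on `H¹(G, μ)`:
`f ∈ dom H_μ` and `H_μ f = h`. Elements of the form domain `H¹(G, μ)` stand for their classes in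
`L²(G, μ)`. -/
def IsLaplacian [Fintype E] (G : MetricGraph V E) (μ : Measure G.Point) (f h : G.Point → ℝ) :
    Prop :=
  G.MemH1Measure μ f ∧ MemLp h 2 μ ∧
    ∀ φ, G.MemH1Measure μ φ → G.energy f φ = ∫ x, h x * φ x ∂μ

/-- `f` is an eigenfunction of `H_μ` for the eigenvalue `a`. -/
def IsEigenfunction [Fintype E] (G : MetricGraph V E) (μ : Measure G.Point) (a : ℝ)
    (f : G.Point → ℝ) : Prop :=
  f ≠ 0 ∧ G.IsLaplacian μ f (a • f)

/-- The span of all eigenfunctions of `H_μ` for eigenvalues at most `a`. Its dimension is the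
number of eigenvalues at most `a`, counted with multiplicity. -/
def lowEigenspace [Fintype E] (G : MetricGraph V E) (μ : Measure G.Point) (a : ℝ) :
    Submodule ℝ (G.Point → ℝ) :=
  Submodule.span ℝ {f | ∃ b ≤ a, G.IsEigenfunction μ b f}

/-- The eigenvalue `λ_k(H_μ) ∈ [0, ∞]`, `k = 0, 1, 2, …`, in the increasing enumeration of the
eigenvalues of the nonnegative operator `H_μ` with multiplicities: the least `a` such that at least
`k + 1` eigenvalues are at most `a`. It is `∞` if `H_μ` has at most `k` eigenvalues. -/
def eigenvalue [Fintype E] (G : MetricGraph V E) (k : ℕ) (μ : Measure G.Point) : ℝ≥0∞ :=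
  ⨅ (a : ℝ≥0) (_ : ((k + 1 : ℕ) : Cardinal) ≤ Module.rank ℝ (G.lowEigenspace μ a)), (a : ℝ≥0∞)

/-- The optimal eigenvalue `λ_k^min(G)`, over all Borel probability measures on `G`. -/
def optimalEigenvalue [Fintype E] (G : MetricGraph V E) (k : ℕ) : ℝ≥0∞ :=
  ⨅ μ : ProbabilityMeasure G.Point, G.eigenvalue k (μ : Measure G.Point)

/-! ### The effective resistance -/

/-- `f` is the solution in `H¹(G)` of `Δ f = δ_x - δ_y`, `f(y) = 0`. -/
def IsPotential [Fintype E] (G : MetricGraph V E) (x y : G.Point) (f : G.Point → ℝ) : Prop :=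
  G.MemH1 f ∧ (∀ g, G.MemH1 g → G.energy f g = g x - g y) ∧ f y = 0

open Classical in
/-- The effective resistance `r(x, y) = f(x)`, where `f` solves `Δ f = δ_x - δ_y`, `f(y) = 0`. -/
def resistance [Fintype E] (G : MetricGraph V E) (x y : G.Point) : ℝ :=
  if h : ∃ f, G.IsPotential x y f then h.choose x else 0

/-- The diameter of the metric graph in the resistance metric. -/
def resistanceDiam [Fintype E] (G : MetricGraph V E) : ℝ :=
  sSup (range fun p : G.Point × G.Point => G.resistance p.1 p.2)

/-- The measure `μ_{x,y} = (δ_x + δ_y) / 2`. -/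
def twoPointMeasure (G : MetricGraph V E) (x y : G.Point) : Measure G.Point :=
  (2⁻¹ : ℝ≥0∞) • (Measure.dirac x + Measure.dirac y)

end MetricGraph

end

/-! ### Weak derivatives on an interval -/

/-! Write `q` for the energy, `r` for the resistance and `D` for its maximum. If `h` is the
potential of `x, y`, then `f x - f y = q(h, f)` and `q(h, h) = r(x, y)`, so Cauchy–Schwarz gives `(f
x - f y)² ≤ r(x, y) q(f, f)`.

Lower bound: normalize a nonconstant eigenfunction for an eigenvalue at most `a` to unit energy. It
has mean zero and `1 ≤ a ∫ f² dμ`. A mean-zero function with maximum `M` and minimum `m` satisfies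
`∫ f² dμ ≤ -M m ≤ (M - m)² / 4`, which is at most `D / 4`; hence `4 ≤ a D`
(`four_le_mul_resistanceDiam`). Conversely, for `μ_{x,y}` with `r(x, y) = D > 0` the potential minus
`D / 2` is an eigenfunction for `4 / D` (`eigenvalue_one_twoPointMeasure_le`).

Equality: near-optimal eigenfunctions nearly saturate every inequality above. Their extremal points
converge along an ultrafilter to a pair at resistance `D`, and in energy, hence uniformly, the
functions converge to a multiple of `h - D / 2` (`exists_potential_of_eigenvalue_eq`). The variance
of the limit forces `h` to take only its extreme values `0` and `D` almost everywhere, each of which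
is attained at one point only (`eq_twoPointMeasure_of_potential`).

Trees: projecting to the edges turns both the path metric and the resistance into the same sum over
edges, because a potential is a unit flow along the path from `x` to `y` (`IsTree.isPotential`,
`IsTree.pathDist_eq`). -/

lemma MeasureTheory.MemLp.intervalIntegrable_of_Ioo {a b s t : ℝ} {v : ℝ → ℝ}
    (hv : MemLp v 2 (volume.restrict (Ioo a b))) (hs : s ∈ Icc a b) (ht : t ∈ Icc a b) :
    IntervalIntegrable v volume s t := by
  have h : IntegrableOn v (Ioo a b) := hv.integrable (by norm_num)
  have h' : IntervalIntegrable v volume a b :=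
    (intervalIntegrable_iff_integrableOn_Ioo_of_le (hs.1.trans hs.2)).2 h
  refine h'.mono_set ?_
  rw [uIcc_of_le (hs.1.trans hs.2)]
  exact uIcc_subset_Icc hs ht

lemma intervalIntegral_eq_integral_Ioo {a b : ℝ} (hab : a ≤ b) (f : ℝ → ℝ) :
    ∫ x in a..b, f x = ∫ x in Ioo a b, f x := by
  rw [intervalIntegral.integral_of_le hab, integral_Ioc_eq_integral_Ioo]

/-- A primitive of an integrable function has that function as weak derivative. -/
lemma integral_primitive_mul_deriv {a b : ℝ} (hab : a < b) {v φ : ℝ → ℝ}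
    (hv : IntervalIntegrable v volume a b) (hφ : ContDiff ℝ ∞ φ)
    (hsupp : tsupport φ ⊆ Ioo a b) :
    ∫ x in Ioo a b, (∫ y in a..x, v y) * deriv φ x = -∫ x in Ioo a b, v x * φ x := by
  have hf := hv.absolutelyContinuousOnInterval_intervalIntegral (c := a) left_mem_uIcc
  have hg : AbsolutelyContinuousOnInterval φ a b :=
    (hφ.of_le (by simp) : ContDiff ℝ 1 φ).contDiffOn.absolutelyContinuousOnInterval
  have h := hf.integral_mul_deriv_eq_deriv_mul hg
  have ha : φ a = 0 := image_eq_zero_of_notMem_tsupport fun h => (hsupp h).1.false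
  have hb : φ b = 0 := image_eq_zero_of_notMem_tsupport fun h => (hsupp h).2.false
  have h' : ∫ x in a..b, deriv (fun x => ∫ y in a..x, v y) x * φ x = ∫ x in a..b, v x * φ x := by
    apply intervalIntegral.integral_congr_ae
    filter_upwards [hv.ae_hasDerivAt_integral] with x hx hx'
    rw [(hx (uIoc_subset_uIcc hx') a left_mem_uIcc).deriv]
  rw [h', ha, hb, intervalIntegral_eq_integral_Ioo hab.le (fun x => v x * φ x),
    intervalIntegral_eq_integral_Ioo hab.le] at h
  rw [h]
  ring

/-- The du Bois-Reymond lemma. -/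
lemma exists_eq_const_of_integral_mul_deriv_eq_zero {a b : ℝ} (hab : a < b) {w : ℝ → ℝ}
    (hw : ContinuousOn w (Icc a b))
    (h : ∀ φ : ℝ → ℝ, ContDiff ℝ ∞ φ → HasCompactSupport φ → tsupport φ ⊆ Ioo a b →
      ∫ x in Ioo a b, w x * deriv φ x = 0) :
    ∃ c, ∀ x ∈ Icc a b, w x = c := by
  have hwi : IntegrableOn w (Ioo a b) := hw.integrableOn_Icc.mono_set Ioo_subset_Icc_self
  have hwmul : ∀ ψ : ℝ → ℝ, Continuous ψ → IntegrableOn (fun x => w x * ψ x) (Ioo a b) :=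
    fun ψ hψ => (hw.mul hψ.continuousOn).integrableOn_Icc.mono_set Ioo_subset_Icc_self
  let B : ContDiffBump ((a + b) / 2) := ⟨(b - a) / 8, (b - a) / 4, by linarith, by linarith⟩
  set β : ℝ → ℝ := B.normed volume
  have hβ : ContDiff ℝ ∞ β := B.contDiff_normed
  have hβc : HasCompactSupport β := B.hasCompactSupport_normed
  have hβt : tsupport β ⊆ Ioo a b := by
    rw [B.tsupport_normed_eq, Real.closedBall_eq_Icc]
    intro x hx
    simp only [B, mem_Icc] at hx
    constructor <;> linarith [hx.1, hx.2]
  have hβ1 : ∫ x, β x = 1 := B.integral_normed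
  refine ⟨∫ x in Ioo a b, w x * β x, ?_⟩
  set c := ∫ x in Ioo a b, w x * β x with hc
  have key : ∀ ψ : ℝ → ℝ, ContDiff ℝ ∞ ψ → HasCompactSupport ψ → tsupport ψ ⊆ Ioo a b →
      ∫ x, ψ x • (w x - c) = 0 := by
    intro ψ hψ hψc hψt
    set I := ∫ x, ψ x with hI
    -- Subtracting `I * β` makes the mean vanish, so the primitive of `η` has compact support and is
    -- an admissible test function.
    set η : ℝ → ℝ := fun x => ψ x - I * β x with hη
    have hηd : ContDiff ℝ ∞ η := hψ.sub (contDiff_const.mul hβ)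
    have hψi : Integrable ψ := hψ.continuous.integrable_of_hasCompactSupport hψc
    have hβi : Integrable β := hβ.continuous.integrable_of_hasCompactSupport hβc
    have hηi : Integrable η := hψi.sub (hβi.const_mul I)
    have hη0 : ∫ x, η x = 0 := by
      rw [hη, integral_sub hψi (hβi.const_mul I), integral_const_mul, hβ1]; simp [hI]
    set K := tsupport ψ ∪ tsupport β
    have hK : IsCompact K := hψc.isCompact.union hβc.isCompact
    have hKs : K ⊆ Ioo a b := union_subset hψt hβt
    have hKn : K.Nonempty := by
      by_contra hne
      have : β = 0 := by
        rw [← tsupport_eq_empty_iff]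
        exact subset_empty_iff.1 (subset_union_right.trans (not_nonempty_iff_eq_empty.1 hne).le)
      rw [this] at hβ1
      simp at hβ1
    obtain ⟨p, hpK, hp⟩ := hK.exists_isLeast hKn
    obtain ⟨q, hqK, hq⟩ := hK.exists_isGreatest hKn
    have hηz : ∀ x, x ∉ Icc p q → η x = 0 := by
      intro x hx
      have hxK : x ∉ K := fun hxK => hx ⟨hp hxK, hq hxK⟩
      have h1 : ψ x = 0 := image_eq_zero_of_notMem_tsupport fun h => hxK (Or.inl h)
      have h2 : β x = 0 := image_eq_zero_of_notMem_tsupport fun h => hxK (Or.inr h)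
      simp [hη, h1, h2]
    set φ : ℝ → ℝ := fun x => ∫ y in a..x, η y
    have hφ' : ∀ x, HasDerivAt φ (η x) x := fun x =>
      intervalIntegral.integral_hasDerivAt_right (hηi.intervalIntegrable)
        hηd.continuous.stronglyMeasurable.stronglyMeasurableAtFilter hηd.continuous.continuousAt
    have hφd : deriv φ = η := funext fun x => (hφ' x).deriv
    have hφs : ContDiff ℝ ∞ φ := by
      rw [contDiff_infty_iff_deriv, hφd]
      exact ⟨fun x => (hφ' x).differentiableAt, hηd⟩
    have hpq : Icc p q ⊆ Ioo a b := fun x hx =>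
      ⟨(hKs hpK).1.trans_le hx.1, hx.2.trans_lt (hKs hqK).2⟩
    -- Below `p` the integrand vanishes; above `q` the primitive equals the total integral of `η`,
    -- which is zero.
    have hφt : tsupport φ ⊆ Icc p q := by
      refine closure_minimal ?_ isClosed_Icc
      intro x hx
      by_contra hxn
      apply hx
      rw [mem_Icc, not_and_or, not_le, not_le] at hxn
      rcases hxn with hxp | hxq
      · have : EqOn η (fun _ => 0) (uIcc a x) := by
          intro y hy
          apply hηz
          intro hy'
          have := hy.2
          have := (hKs hpK).1
          rcases max_cases a x with h | h <;> linarith [hy'.1]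
        simp only [φ]
        rw [intervalIntegral.integral_congr this]; simp
      · have hax : a ≤ x := ((hKs hqK).1.trans hxq).le
        simp only [φ]
        rw [intervalIntegral.integral_of_le hax, ← hη0]
        refine setIntegral_eq_integral_of_forall_compl_eq_zero fun y hy => hηz y fun hy' => hy ?_
        exact ⟨(hKs hpK).1.trans_le hy'.1, hy'.2.trans hxq.le⟩
    have h0 := h φ hφs (isCompact_Icc.of_isClosed_subset (isClosed_tsupport _) hφt)
      (hφt.trans hpq)
    rw [hφd] at h0
    have h1 : ∫ x in Ioo a b, w x * η x = (∫ x in Ioo a b, w x * ψ x) - I * c := by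
      rw [hc, ← integral_const_mul, ← integral_sub (hwmul ψ hψ.continuous)
        ((hwmul β hβ.continuous).const_mul I)]
      congr 1; ext x; simp only [hη]; ring
    have h2 : ∫ x, ψ x • (w x - c) = ∫ x in Ioo a b, ψ x • (w x - c) := by
      refine (setIntegral_eq_integral_of_forall_compl_eq_zero fun x hx => ?_).symm
      rw [image_eq_zero_of_notMem_tsupport fun h => hx (hψt h), zero_smul]
    have h3 : ∫ x in Ioo a b, ψ x = I := by
      refine setIntegral_eq_integral_of_forall_compl_eq_zero fun x hx => ?_
      exact image_eq_zero_of_notMem_tsupport fun h => hx (hψt h)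
    have h4 : ∫ x in Ioo a b, ψ x • (w x - c) = (∫ x in Ioo a b, w x * ψ x) - I * c := by
      rw [← h3, ← integral_mul_const, ← integral_sub (hwmul ψ hψ.continuous)
        (hψi.integrableOn.mul_const c)]
      congr 1; ext x; simp only [smul_eq_mul]; ring
    rw [h2, h4, ← h1, h0]
  have hae := isOpen_Ioo.ae_eq_zero_of_integral_contDiff_smul_eq_zero
    ((hwi.sub (integrableOn_const (by simp))).locallyIntegrableOn) key
  have hae' : w =ᵐ[volume.restrict (Ioo a b)] fun _ => c := by
    rw [Filter.EventuallyEq, ae_restrict_iff' measurableSet_Ioo]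
    filter_upwards [hae] with x hx hx'
    exact sub_eq_zero.1 (hx hx')
  rw [restrict_Ioo_eq_restrict_Icc] at hae'
  exact Measure.eqOn_Icc_of_ae_eq volume hab.ne hae' hw continuousOn_const

/-- A continuous function is a primitive of its square integrable weak derivative. -/
lemma IsL2WeakDerivOn.sub_eq_integral {a b : ℝ} (hab : a < b) {u v : ℝ → ℝ}
    (hu : ContinuousOn u (Icc a b)) (h : IsL2WeakDerivOn a b u v) {s t : ℝ}
    (hs : s ∈ Icc a b) (ht : t ∈ Icc a b) : u t - u s = ∫ x in s..t, v x := by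
  have hv := fun {s t : ℝ} => h.1.intervalIntegrable_of_Ioo (s := s) (t := t)
  have ha : a ∈ Icc a b := left_mem_Icc.2 hab.le
  have hb : b ∈ Icc a b := right_mem_Icc.2 hab.le
  have hP : ContinuousOn (fun x => ∫ y in a..x, v y) (Icc a b) := by
    have := intervalIntegral.continuousOn_primitive_interval' (hv ha hb) left_mem_uIcc
    rwa [uIcc_of_le hab.le] at this
  -- `u` minus a primitive of `v` has weak derivative zero.
  obtain ⟨c, hc⟩ := exists_eq_const_of_integral_mul_deriv_eq_zero hab (hu.sub hP) (by
    intro φ hφ hφc hφt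
    have hφ' : Continuous (deriv φ) := hφ.continuous_deriv (by norm_num)
    have h1 : IntegrableOn (fun x => u x * deriv φ x) (Ioo a b) :=
      (hu.mul hφ'.continuousOn).integrableOn_Icc.mono_set Ioo_subset_Icc_self
    have h2 : IntegrableOn (fun x => (∫ y in a..x, v y) * deriv φ x) (Ioo a b) :=
      (hP.mul hφ'.continuousOn).integrableOn_Icc.mono_set Ioo_subset_Icc_self
    simp only [Pi.sub_apply, sub_mul]
    rw [integral_sub h1 h2, h.2 φ hφ hφc hφt, integral_primitive_mul_deriv hab (hv ha hb) hφ hφt,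
      sub_self])
  have h1 := hc s hs
  have h2 := hc t ht
  simp only [Pi.sub_apply] at h1 h2
  have h3 := intervalIntegral.integral_add_adjacent_intervals (hv ha hs) (hv hs ht)
  linarith

/-- Converse of `IsL2WeakDerivOn.sub_eq_integral`: the constant `u a` contributes nothing, since a
test function vanishes at both end points. -/
lemma isL2WeakDerivOn_of_sub_eq_integral {a b : ℝ} (hab : a < b) {u v : ℝ → ℝ}
    (hv : MemLp v 2 (volume.restrict (Ioo a b)))
    (h : ∀ t ∈ Icc a b, u t - u a = ∫ x in a..t, v x) : IsL2WeakDerivOn a b u v := by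
  refine ⟨hv, fun φ hφ hφc hφt => ?_⟩
  have ha : a ∈ Icc a b := left_mem_Icc.2 hab.le
  have hb : b ∈ Icc a b := right_mem_Icc.2 hab.le
  have hvi := hv.intervalIntegrable_of_Ioo ha hb
  have hφ' : Continuous (deriv φ) := hφ.continuous_deriv (by norm_num)
  have hP : ContinuousOn (fun x => ∫ y in a..x, v y) (Icc a b) := by
    have := intervalIntegral.continuousOn_primitive_interval' hvi left_mem_uIcc
    rwa [uIcc_of_le hab.le] at this
  have h2 : IntegrableOn (fun x => (∫ y in a..x, v y) * deriv φ x) (Ioo a b) :=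
    (hP.mul hφ'.continuousOn).integrableOn_Icc.mono_set Ioo_subset_Icc_self
  have h3 : IntegrableOn (fun x => u a * deriv φ x) (Ioo a b) :=
    (continuous_const.mul hφ').continuousOn.integrableOn_Icc.mono_set Ioo_subset_Icc_self
  have hd : ∫ x in Ioo a b, deriv φ x = 0 := by
    rw [← intervalIntegral_eq_integral_Ioo hab.le,
      intervalIntegral.integral_deriv_eq_sub (fun x _ => hφ.differentiable (by norm_num) x)
        (hφ'.intervalIntegrable _ _),
      image_eq_zero_of_notMem_tsupport fun h => (hφt h).1.false,
      image_eq_zero_of_notMem_tsupport fun h => (hφt h).2.false, sub_self]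
  rw [← integral_primitive_mul_deriv hab hvi hφ hφt]
  have : ∫ x in Ioo a b, u x * deriv φ x
      = ∫ x in Ioo a b, (u a * deriv φ x + (∫ y in a..x, v y) * deriv φ x) := by
    refine setIntegral_congr_fun measurableSet_Ioo fun x hx => ?_
    have := h x (Ioo_subset_Icc_self hx)
    grind
  rw [this, integral_add h3 h2, integral_const_mul, hd, mul_zero, zero_add]

/-- The fundamental lemma of the calculus of variations, applied to `v - v'`. It makes the choice in
`weakDerivOn` immaterial. -/
lemma IsL2WeakDerivOn.ae_eq {a b : ℝ} {u v v' : ℝ → ℝ} (h : IsL2WeakDerivOn a b u v)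
    (h' : IsL2WeakDerivOn a b u v') : v =ᵐ[volume.restrict (Ioo a b)] v' := by
  have hi : IntegrableOn v (Ioo a b) := h.1.integrable (by norm_num)
  have hi' : IntegrableOn v' (Ioo a b) := h'.1.integrable (by norm_num)
  have hae := isOpen_Ioo.ae_eq_zero_of_integral_contDiff_smul_eq_zero (μ := volume)
    (hi.sub hi').locallyIntegrableOn (by
      intro φ hφ hφc hφt
      have hm : ∀ {f : ℝ → ℝ}, IntegrableOn f (Ioo a b) →
          IntegrableOn (fun x => f x * φ x) (Ioo a b) := by
        intro f hf
        obtain ⟨C, hC⟩ := hφc.exists_bound_of_continuous hφ.continuous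
        exact hf.mul_bdd (c := C) hφ.continuous.aestronglyMeasurable
          (Filter.Eventually.of_forall hC)
      have : ∫ x, φ x • (v - v') x = ∫ x in Ioo a b, (v x * φ x - v' x * φ x) := by
        rw [← setIntegral_eq_integral_of_forall_compl_eq_zero (s := Ioo a b)]
        · congr 1; ext x; simp only [smul_eq_mul, Pi.sub_apply]; ring
        · intro x hx
          rw [image_eq_zero_of_notMem_tsupport fun h => hx (hφt h), zero_smul]
      rw [this, integral_sub (hm hi) (hm hi')]
      have h1 := h.2 φ hφ hφc hφt
      have h2 := h'.2 φ hφ hφc hφt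
      linarith)
  rw [Filter.EventuallyEq, ae_restrict_iff' measurableSet_Ioo]
  filter_upwards [hae] with x hx hx'
  have := hx hx'
  simp only [Pi.sub_apply] at this
  linarith

lemma MemSobolevInterval.isL2WeakDerivOn {a b : ℝ} {u : ℝ → ℝ} (h : MemSobolevInterval a b u) :
    IsL2WeakDerivOn a b u (weakDerivOn a b u) := by
  unfold weakDerivOn
  rw [dif_pos h.2]
  exact h.2.choose_spec

namespace MetricGraph

variable {V E : Type*}

/-! ### Points and continuous functions -/

/-- The point of the metric graph given by a vertex. -/
def vertex (G : MetricGraph V E) (v : V) : G.Point := Quot.mk G.Glue (Sum.inl v)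

lemma left_mem (G : MetricGraph V E) (e : E) : (0 : ℝ) ∈ Icc 0 (G.len e) :=
  left_mem_Icc.2 (G.len_pos e).le

lemma right_mem (G : MetricGraph V E) (e : E) : G.len e ∈ Icc 0 (G.len e) :=
  right_mem_Icc.2 (G.len_pos e).le

lemma edgePoint_zero (G : MetricGraph V E) (e : E) :
    G.edgePoint e ⟨0, G.left_mem e⟩ = G.vertex (G.src e) := Quot.sound (Glue.left e)

lemma edgePoint_len (G : MetricGraph V E) (e : E) :
    G.edgePoint e ⟨G.len e, G.right_mem e⟩ = G.vertex (G.tgt e) := Quot.sound (Glue.right e)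

lemma point_cases (G : MetricGraph V E) (x : G.Point) :
    (∃ v, x = G.vertex v) ∨ ∃ e t, x = G.edgePoint e t := by
  induction x using Quot.ind with
  | mk p => rcases p with v | ⟨e, t⟩
            · exact Or.inl ⟨v, rfl⟩
            · exact Or.inr ⟨e, t, rfl⟩

lemma point_cases_interior (G : MetricGraph V E) (x : G.Point) :
    (∃ v, x = G.vertex v) ∨ ∃ e, ∃ t : Icc (0 : ℝ) (G.len e),
      0 < (t : ℝ) ∧ (t : ℝ) < G.len e ∧ x = G.edgePoint e t := by
  rcases G.point_cases x with h | ⟨e, ⟨t, ht⟩, rfl⟩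
  · exact Or.inl h
  · rcases ht.1.eq_or_lt with rfl | h0
    · exact Or.inl ⟨_, G.edgePoint_zero e⟩
    · rcases ht.2.eq_or_lt with rfl | h1
      · exact Or.inl ⟨_, G.edgePoint_len e⟩
      · exact Or.inr ⟨e, ⟨t, ht⟩, h0, h1, rfl⟩

/-- A relation that is preserved along the edges holds between all points. -/
lemma point_rel_induction (G : MetricGraph V E) {R : G.Point → G.Point → Prop}
    (hR : Equivalence R) (h : ∀ e s t, R (G.edgePoint e s) (G.edgePoint e t)) (x y : G.Point) :
    R x y := by
  have hv : ∀ u v : V, R (G.vertex u) (G.vertex v) := by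
    intro u v
    induction G.connected u v with
    | rel a b hab =>
      obtain ⟨e, rfl, rfl⟩ := hab
      rw [← edgePoint_zero, ← edgePoint_len]
      exact h e _ _
    | refl a => exact hR.refl _
    | symm a b _ ih => exact hR.symm ih
    | trans a b c _ _ h1 h2 => exact hR.trans h1 h2
  have hx : ∀ x : G.Point, ∃ v, R x (G.vertex v) := by
    intro x
    rcases G.point_cases x with ⟨v, rfl⟩ | ⟨e, t, rfl⟩
    · exact ⟨v, hR.refl _⟩
    · exact ⟨G.src e, by rw [← edgePoint_zero]; exact h e _ _⟩
  obtain ⟨u, hu⟩ := hx x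
  obtain ⟨v, hv'⟩ := hx y
  exact hR.trans hu (hR.trans (hv u v) (hR.symm hv'))

lemma eq_of_edgewise_eq (G : MetricGraph V E) {α : Type*} {F : G.Point → α}
    (h : ∀ e s t, F (G.edgePoint e s) = F (G.edgePoint e t)) (x y : G.Point) : F x = F y :=
  G.point_rel_induction (R := fun x y => F x = F y)
    ⟨fun _ => rfl, fun h => h.symm, fun h h' => h.trans h'⟩ h x y

/-- By the universal property of the quotient, continuity is tested on the pieces, and the discrete
vertices impose no condition. -/
lemma continuous_iff_edgewise (G : MetricGraph V E) {α : Type*} [TopologicalSpace α]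
    {f : G.Point → α} : Continuous f ↔ ∀ e, Continuous fun t => f (G.edgePoint e t) := by
  let _ : TopologicalSpace V := ⊥
  have : DiscreteTopology V := ⟨rfl⟩
  rw [show Continuous f ↔ Continuous (f ∘ Quot.mk G.Glue) from continuous_coinduced_dom,
    continuous_sum_dom, continuous_sigma_iff]
  exact ⟨fun h e => h.2 e, fun h => ⟨continuous_of_discreteTopology, h⟩⟩

lemma continuous_edgePoint (G : MetricGraph V E) (e : E) : Continuous (G.edgePoint e) :=
  G.continuous_iff_edgewise.1 continuous_id e

instance instCompactSpacePoint [Finite V] [Finite E] (G : MetricGraph V E) :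
    CompactSpace G.Point := by
  let _ : TopologicalSpace V := ⊥
  have : DiscreteTopology V := ⟨rfl⟩
  refine ⟨?_⟩
  have h : IsCompact (range (Quot.mk G.Glue)) := isCompact_range continuous_coinduced_rng
  rwa [Quot.mk_surjective.range_eq] at h

instance instNonemptyPoint (G : MetricGraph V E) : Nonempty G.Point :=
  G.nonempty.map G.vertex

lemma onEdge_apply (G : MetricGraph V E) (f : G.Point → ℝ) (e : E) (t : Icc (0 : ℝ) (G.len e)) :
    G.onEdge f e t = f (G.edgePoint e t) := IccExtend_val _ _ t

lemma continuous_onEdge (G : MetricGraph V E) {f : G.Point → ℝ} (hf : Continuous f) (e : E) :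
    Continuous (G.onEdge f e) :=
  (hf.comp (G.continuous_edgePoint e)).Icc_extend'

/-! ### Gradients -/

/-- `v e` is a square integrable derivative of the continuous function `f` on the edge `e`. -/
structure HasGrad (G : MetricGraph V E) (f : G.Point → ℝ) (v : E → ℝ → ℝ) : Prop where
  continuous : Continuous f
  memLp : ∀ e, MemLp (v e) 2 (volume.restrict (Ioo 0 (G.len e)))
  sub_eq : ∀ e (s t : Icc (0 : ℝ) (G.len e)),
    f (G.edgePoint e t) - f (G.edgePoint e s) = ∫ x in (s : ℝ)..t, v e x

variable {G : MetricGraph V E} {f g : G.Point → ℝ} {v w : E → ℝ → ℝ}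

lemma HasGrad.isL2WeakDerivOn (h : G.HasGrad f v) (e : E) :
    IsL2WeakDerivOn 0 (G.len e) (G.onEdge f e) (v e) := by
  refine isL2WeakDerivOn_of_sub_eq_integral (G.len_pos e) (h.memLp e) fun t ht => ?_
  have := h.sub_eq e ⟨0, G.left_mem e⟩ ⟨t, ht⟩
  rwa [← G.onEdge_apply f, ← G.onEdge_apply f] at this

lemma HasGrad.memH1 (h : G.HasGrad f v) : G.MemH1 f := by
  refine ⟨h.continuous, fun e => ⟨?_, _, h.isL2WeakDerivOn e⟩⟩
  have hc := (G.continuous_onEdge h.continuous e)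
  have : IsCompact (Icc 0 (G.len e)) := isCompact_Icc
  obtain ⟨C, hC⟩ := this.exists_bound_of_continuousOn hc.continuousOn
  refine MemLp.of_bound hc.aestronglyMeasurable C ?_
  filter_upwards [ae_restrict_mem measurableSet_Ioo] with x hx
  exact hC x (Ioo_subset_Icc_self hx)

/-- The weak gradient. -/
noncomputable def grad (G : MetricGraph V E) (f : G.Point → ℝ) (e : E) : ℝ → ℝ :=
  weakDerivOn 0 (G.len e) (G.onEdge f e)

lemma MemH1.hasGrad (h : G.MemH1 f) : G.HasGrad f (G.grad f) := by
  refine ⟨h.1, fun e => (h.2 e).isL2WeakDerivOn.1, fun e s t => ?_⟩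
  rw [← G.onEdge_apply f, ← G.onEdge_apply f]
  exact (h.2 e).isL2WeakDerivOn.sub_eq_integral (G.len_pos e)
    (G.continuous_onEdge h.1 e).continuousOn s.2 t.2

lemma HasGrad.grad_ae_eq (h : G.HasGrad f v) (e : E) :
    G.grad f e =ᵐ[volume.restrict (Ioo 0 (G.len e))] v e :=
  (h.memH1.2 e).isL2WeakDerivOn.ae_eq (h.isL2WeakDerivOn e)

/-- Any square integrable representative of the derivative computes the energy, so explicit
functions can be treated without unfolding `weakDerivOn`. -/
lemma HasGrad.energy_eq [Fintype E] (hf : G.HasGrad f v) (hg : G.HasGrad g w) :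
    G.energy f g = ∑ e, ∫ x in Ioo 0 (G.len e), v e x * w e x := by
  refine Finset.sum_congr rfl fun e _ => integral_congr_ae ?_
  filter_upwards [hf.grad_ae_eq e, hg.grad_ae_eq e] with x h1 h2
  rw [← h1, ← h2]; rfl

lemma HasGrad.intervalIntegrable (h : G.HasGrad f v) (e : E) (s t : Icc (0 : ℝ) (G.len e)) :
    IntervalIntegrable (v e) volume s t :=
  (h.memLp e).intervalIntegrable_of_Ioo s.2 t.2

lemma HasGrad.add (hf : G.HasGrad f v) (hg : G.HasGrad g w) : G.HasGrad (f + g) (v + w) := by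
  refine ⟨hf.continuous.add hg.continuous, fun e => (hf.memLp e).add (hg.memLp e),
    fun e s t => ?_⟩
  have := intervalIntegral.integral_add (hf.intervalIntegrable e s t) (hg.intervalIntegrable e s t)
  simp only [Pi.add_apply]
  rw [this, ← hf.sub_eq, ← hg.sub_eq]; ring

lemma HasGrad.smul (c : ℝ) (hf : G.HasGrad f v) : G.HasGrad (c • f) (c • v) := by
  refine ⟨hf.continuous.const_smul c, fun e => (hf.memLp e).const_smul c, fun e s t => ?_⟩
  simp only [Pi.smul_apply, smul_eq_mul]
  rw [intervalIntegral.integral_const_mul, ← hf.sub_eq]; ring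

lemma hasGrad_const (G : MetricGraph V E) (c : ℝ) : G.HasGrad (fun _ => c) 0 :=
  ⟨continuous_const, fun _ => MemLp.zero', fun e s t => by simp⟩

/-- The Sobolev space `H¹(G)` as a vector space. -/
def sobolev (G : MetricGraph V E) : Submodule ℝ (G.Point → ℝ) where
  carrier := {f | G.MemH1 f}
  add_mem' := fun hf hg => (hf.hasGrad.add hg.hasGrad).memH1
  zero_mem' := (G.hasGrad_const 0).memH1
  smul_mem' := fun c _ hf => (hf.hasGrad.smul c).memH1

lemma memH1_const (G : MetricGraph V E) (c : ℝ) : G.MemH1 fun _ => c := (G.hasGrad_const c).memH1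

lemma MemH1.add (hf : G.MemH1 f) (hg : G.MemH1 g) : G.MemH1 (f + g) := G.sobolev.add_mem hf hg
lemma MemH1.sub (hf : G.MemH1 f) (hg : G.MemH1 g) : G.MemH1 (f - g) := G.sobolev.sub_mem hf hg
lemma MemH1.smul (c : ℝ) (hf : G.MemH1 f) : G.MemH1 (c • f) := G.sobolev.smul_mem c hf

lemma HasGrad.integrable_mul (hf : G.HasGrad f v) (hg : G.HasGrad g w) (e : E) :
    IntegrableOn (fun x => v e x * w e x) (Ioo 0 (G.len e)) :=
  (hf.memLp e).integrable_mul (hg.memLp e)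

/-! ### The energy form and its Sobolev inequality -/

section Energy

variable [Fintype E]

lemma energy_comm (G : MetricGraph V E) (f g : G.Point → ℝ) : G.energy f g = G.energy g f := by
  simp only [energy, mul_comm]

lemma energy_add_left {f' : G.Point → ℝ} (hf : G.MemH1 f) (hf' : G.MemH1 f') (hg : G.MemH1 g) :
    G.energy (f + f') g = G.energy f g + G.energy f' g := by
  rw [(hf.hasGrad.add hf'.hasGrad).energy_eq hg.hasGrad, hf.hasGrad.energy_eq hg.hasGrad,
    hf'.hasGrad.energy_eq hg.hasGrad, ← Finset.sum_add_distrib]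
  refine Finset.sum_congr rfl fun e _ => ?_
  rw [← integral_add (hf.hasGrad.integrable_mul hg.hasGrad e)
    (hf'.hasGrad.integrable_mul hg.hasGrad e)]
  congr 1; ext x; simp [add_mul]

lemma energy_smul_left (c : ℝ) (hf : G.MemH1 f) (hg : G.MemH1 g) :
    G.energy (c • f) g = c * G.energy f g := by
  rw [(hf.hasGrad.smul c).energy_eq hg.hasGrad, hf.hasGrad.energy_eq hg.hasGrad, Finset.mul_sum]
  refine Finset.sum_congr rfl fun e _ => ?_
  rw [← integral_const_mul]
  congr 1; ext x; simp [mul_assoc]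

lemma energy_self_nonneg (G : MetricGraph V E) (f : G.Point → ℝ) : 0 ≤ G.energy f f :=
  Finset.sum_nonneg fun _ _ => integral_nonneg fun _ => mul_self_nonneg _

/-- The energy form on the Sobolev space. -/
noncomputable def energyForm (G : MetricGraph V E) : LinearMap.BilinForm ℝ G.sobolev :=
  LinearMap.mk₂ ℝ (fun f g => G.energy f g)
    (fun f f' g => energy_add_left f.2 f'.2 g.2) (fun c f g => energy_smul_left c f.2 g.2)
    (fun f g g' => by
      rw [G.energy_comm f, G.energy_comm f, G.energy_comm f]; exact energy_add_left g.2 g'.2 f.2)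
    (fun c f g => by rw [G.energy_comm f, G.energy_comm f]; exact energy_smul_left c g.2 f.2)

lemma energy_sub_left {f' : G.Point → ℝ} (hf : G.MemH1 f) (hf' : G.MemH1 f') (hg : G.MemH1 g) :
    G.energy (f - f') g = G.energy f g - G.energy f' g := by
  exact G.energyForm.map_sub₂ ⟨f, hf⟩ ⟨f', hf'⟩ ⟨g, hg⟩

lemma energy_sub_right {g' : G.Point → ℝ} (hf : G.MemH1 f) (hg : G.MemH1 g) (hg' : G.MemH1 g') :
    G.energy f (g - g') = G.energy f g - G.energy f g' := by
  rw [G.energy_comm f, energy_sub_left hg hg' hf, G.energy_comm f, G.energy_comm f]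

lemma energy_smul_right (c : ℝ) (hf : G.MemH1 f) (hg : G.MemH1 g) :
    G.energy f (c • g) = c * G.energy f g := by
  rw [G.energy_comm, energy_smul_left c hg hf, G.energy_comm]

lemma energy_sq_le (hf : G.MemH1 f) (hg : G.MemH1 g) :
    G.energy f g ^ 2 ≤ G.energy f f * G.energy g g :=
  G.energyForm.apply_sq_le_of_symm (fun f => G.energy_self_nonneg f)
    ⟨fun f g => G.energy_comm f g⟩ ⟨f, hf⟩ ⟨g, hg⟩

lemma energy_const_left (c : ℝ) (hg : G.MemH1 g) :
    G.energy (fun _ => c) g = 0 := by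
  rw [(G.hasGrad_const c).energy_eq hg.hasGrad]; simp

lemma energy_sub_const_left (c : ℝ) (hf : G.MemH1 f) (hg : G.MemH1 g) :
    G.energy (f - fun _ => c) g = G.energy f g := by
  rw [energy_sub_left hf (G.memH1_const c) hg, energy_const_left _ hg, sub_zero]

/-- The one-dimensional Sobolev inequality along an edge. -/
lemma sq_sub_le_abs_mul_energy (hf : G.MemH1 f) (e : E) (s t : Icc (0 : ℝ) (G.len e)) :
    (f (G.edgePoint e s) - f (G.edgePoint e t)) ^ 2 ≤ |(s : ℝ) - t| * G.energy f f := by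
  wlog hst : (s : ℝ) ≤ t generalizing s t
  · have := this t s (le_of_not_ge hst)
    rw [abs_sub_comm, ← neg_sub, neg_sq]; exact this
  have h := hf.hasGrad
  set v := G.grad f e with hv
  have hi : IntervalIntegrable v volume s t := h.intervalIntegrable e s t
  have hsub : Ioo (s : ℝ) t ⊆ Ioo 0 (G.len e) := Ioo_subset_Ioo s.2.1 t.2.2
  have hi2 : IntegrableOn (fun x => v x * v x) (Ioo 0 (G.len e)) := h.integrable_mul h e
  have hi3 : IntervalIntegrable (fun x => v x * v x) volume s t :=
    (intervalIntegrable_iff_integrableOn_Ioo_of_le hst).2 (hi2.mono_set hsub)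
  set I := ∫ x in (s : ℝ)..t, v x with hI
  set J := ∫ x in (s : ℝ)..t, v x * v x with hJ
  have hJE : J ≤ G.energy f f := by
    rw [hJ, intervalIntegral_eq_integral_Ioo hst]
    calc ∫ x in Ioo (s : ℝ) t, v x * v x ≤ ∫ x in Ioo 0 (G.len e), v x * v x :=
          setIntegral_mono_set hi2 (Filter.Eventually.of_forall fun x => mul_self_nonneg _)
            hsub.eventuallyLE
      _ ≤ G.energy f f := Finset.single_le_sum
          (f := fun e => ∫ x in Ioo 0 (G.len e), G.grad f e x * G.grad f e x)
          (fun e _ => integral_nonneg fun _ => mul_self_nonneg _) (Finset.mem_univ e)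
  set d := (t : ℝ) - s with hd
  have hd0 : 0 ≤ d := sub_nonneg.2 hst
  -- Cauchy–Schwarz for `v` against the constant `1`, read off from `0 ≤ ∫ (d v - I)² = d (d J -
  -- I²)`; the case `d = 0` is separate.
  have hIJ : I ^ 2 ≤ d * J := by
    have h1 : 0 ≤ ∫ x in (s : ℝ)..t, (d * v x - I) ^ 2 :=
      intervalIntegral.integral_nonneg hst fun x _ => sq_nonneg _
    have h2 : ∫ x in (s : ℝ)..t, (d * v x - I) ^ 2 = d * (d * J - I ^ 2) := by
      have : (fun x => (d * v x - I) ^ 2)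
          = fun x => d ^ 2 * (v x * v x) - 2 * d * I * v x + I ^ 2 := by ext x; ring
      rw [this, intervalIntegral.integral_add ((hi3.const_mul _).sub (hi.const_mul _)) (by simp),
        intervalIntegral.integral_sub (hi3.const_mul _) (hi.const_mul _),
        intervalIntegral.integral_const_mul, intervalIntegral.integral_const_mul, ← hI, ← hJ,
        intervalIntegral.integral_const, smul_eq_mul, ← hd]
      ring
    rw [h2] at h1
    rcases hd0.eq_or_lt with h0 | h0
    · have hst' : (s : ℝ) = t := by linarith
      rw [hI, hst']; simp [← h0]
    · nlinarith [nonneg_of_mul_nonneg_right h1 h0]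
  have hft := h.sub_eq e s t
  rw [abs_sub_comm, abs_of_nonneg hd0, ← neg_sub, neg_sq, hft]
  exact hIJ.trans (mul_le_mul_of_nonneg_left hJE hd0)

/-- The Sobolev inequality makes `f` constant on each edge, and connectedness does the rest. Thus
the kernel of the energy form consists of the constants. -/
lemma eq_of_energy_eq_zero (hf : G.MemH1 f) (h : G.energy f f = 0) (x y : G.Point) :
    f x = f y := by
  refine G.eq_of_edgewise_eq (fun e s t => ?_) x y
  have := sq_sub_le_abs_mul_energy hf e s t
  rw [h, mul_zero] at this
  exact sub_eq_zero.1 (pow_eq_zero_iff two_ne_zero |>.1 (le_antisymm this (sq_nonneg _)))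

end Energy

end MetricGraph

/-- The step function is the derivative of `x ↦ min x a`; pairing it with a derivative produces a
point evaluation at the kink. -/
lemma integral_Ioo_ite_lt_mul (t a : ℝ) (w : ℝ → ℝ) :
    ∫ x in Ioo 0 t, (if x < a then 1 else 0) * w x = ∫ x in Ioo 0 (min t a), w x := by
  rw [← Ioo_inter_Iio, ← setIntegral_indicator measurableSet_Iio]
  refine integral_congr_ae (Filter.Eventually.of_forall fun x => ?_)
  by_cases h : x < a <;> simp [h]

lemma integral_ite_lt {t a : ℝ} (ht : 0 ≤ t) (ha : 0 ≤ a) :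
    ∫ x in (0 : ℝ)..t, (if x < a then (1 : ℝ) else 0) = min t a := by
  have h := integral_Ioo_ite_lt_mul t a fun _ => 1
  simp only [mul_one] at h
  rw [intervalIntegral_eq_integral_Ioo ht, h]
  simp [ht, ha]

lemma measurable_ite_lt (a : ℝ) : Measurable fun x : ℝ => if x < a then (1 : ℝ) else 0 :=
  Measurable.ite measurableSet_Iio measurable_const measurable_const

namespace MetricGraph

variable {V E : Type*}

/-! ### Piecewise affine functions -/

/-- The function with given values at the vertices and given restrictions to the edges. -/
noncomputable def glueFun (G : MetricGraph V E) (c : V → ℝ) (F : E → ℝ → ℝ) (h0 : ∀ e, F e 0 = c (G.src e))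
    (h1 : ∀ e, F e (G.len e) = c (G.tgt e)) : G.Point → ℝ :=
  Quot.lift (Sum.elim c fun p => F p.1 p.2) (by
    rintro _ _ (e | e)
    · exact h0 e
    · exact h1 e)

lemma glueFun_hasGrad {G : MetricGraph V E} {c : V → ℝ} {F : E → ℝ → ℝ}
    (h0 : ∀ e, F e 0 = c (G.src e)) (h1 : ∀ e, F e (G.len e) = c (G.tgt e)) {v : E → ℝ → ℝ}
    (hF : ∀ e, Continuous (F e)) (hv : ∀ e, MemLp (v e) 2 (volume.restrict (Ioo 0 (G.len e))))
    (h : ∀ e, ∀ t ∈ Icc 0 (G.len e), F e t - F e 0 = ∫ x in (0 : ℝ)..t, v e x) :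
    G.HasGrad (G.glueFun c F h0 h1) v := by
  refine ⟨G.continuous_iff_edgewise.2 fun e => (hF e).comp continuous_subtype_val, hv,
    fun e s t => ?_⟩
  rw [← intervalIntegral.integral_interval_sub_left
    ((hv e).intervalIntegrable_of_Ioo (G.left_mem e) t.2)
    ((hv e).intervalIntegrable_of_Ioo (G.left_mem e) s.2), ← h e t t.2, ← h e s s.2]
  change F e t - F e s = _
  ring

/-- The function with given values at the vertices that is affine on every edge. -/
noncomputable def vertexFun (G : MetricGraph V E) (c : V → ℝ) : G.Point → ℝ :=
  G.glueFun c (fun e t => c (G.src e) + (c (G.tgt e) - c (G.src e)) / G.len e * t)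
    (fun e => by simp) (fun e => by have := (G.len_pos e).ne'; field_simp; ring)

lemma vertexFun_vertex (G : MetricGraph V E) (c : V → ℝ) (v : V) :
    G.vertexFun c (G.vertex v) = c v := rfl

lemma vertexFun_hasGrad (G : MetricGraph V E) (c : V → ℝ) :
    G.HasGrad (G.vertexFun c) fun e _ => (c (G.tgt e) - c (G.src e)) / G.len e :=
  glueFun_hasGrad _ _ (fun e => by fun_prop) (fun e => memLp_const _) fun e t _ => by
    rw [intervalIntegral.integral_const]; simp; ring

lemma vertex_sub_vertex {G : MetricGraph V E} {g : G.Point → ℝ} {v : E → ℝ → ℝ}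
    (h : G.HasGrad g v) (e : E) :
    ∫ x in Ioo 0 (G.len e), v e x = g (G.vertex (G.tgt e)) - g (G.vertex (G.src e)) := by
  rw [← edgePoint_zero, ← edgePoint_len, h.sub_eq,
    intervalIntegral_eq_integral_Ioo (G.len_pos e).le]

lemma energy_vertexFun [Fintype E] {G : MetricGraph V E} (c : V → ℝ) {g : G.Point → ℝ}
    (hg : G.MemH1 g) :
    G.energy (G.vertexFun c) g = ∑ e, (c (G.tgt e) - c (G.src e)) / G.len e *
      (g (G.vertex (G.tgt e)) - g (G.vertex (G.src e))) := by
  rw [(G.vertexFun_hasGrad c).energy_eq hg.hasGrad]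
  refine Finset.sum_congr rfl fun e _ => ?_
  rw [integral_const_mul, vertex_sub_vertex hg.hasGrad]

open Classical in
/-- The Green's function of an edge with Dirichlet conditions at both end points. -/
noncomputable def tent (G : MetricGraph V E) (e₀ : E) (a : Icc (0 : ℝ) (G.len e₀)) : G.Point → ℝ :=
  G.glueFun 0 (fun e t => if e = e₀ then min t a - a / G.len e * t else 0)
    (fun e => by simp [a.2.1]) (fun e => by
      have := (G.len_pos e).ne'
      by_cases h : e = e₀
      · subst h; simp [this, a.2.2]
      · simp [h])

lemma tent_vertex (G : MetricGraph V E) (e : E) (a : Icc (0 : ℝ) (G.len e)) (v : V) :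
    G.tent e a (G.vertex v) = 0 := rfl

open Classical in
lemma tent_edgePoint (G : MetricGraph V E) (e₀ : E) (a : Icc (0 : ℝ) (G.len e₀)) (e : E)
    (t : Icc (0 : ℝ) (G.len e)) : G.tent e₀ a (G.edgePoint e t) =
      if e = e₀ then min (t : ℝ) a - a / G.len e * t else 0 := rfl

open Classical in
lemma tent_hasGrad (G : MetricGraph V E) (e₀ : E) (a : Icc (0 : ℝ) (G.len e₀)) :
    G.HasGrad (G.tent e₀ a) fun e x =>
      if e = e₀ then (if x < (a : ℝ) then 1 else 0) - a / G.len e else 0 := by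
  refine glueFun_hasGrad _ _ (fun e => ?_) (fun e => ?_) fun e t ht => ?_
  · by_cases h : e = e₀
    · simp only [h, if_true]; fun_prop
    · simp only [h, if_false]; fun_prop
  · by_cases h : e = e₀
    · simp only [h, if_true]
      refine MemLp.sub (MemLp.of_bound (measurable_ite_lt _).aestronglyMeasurable 1 ?_)
        (memLp_const _)
      filter_upwards with x
      split_ifs <;> simp
    · simp only [h, if_false]; exact memLp_const _
  · by_cases h : e = e₀
    · simp only [h, if_true]
      rw [intervalIntegral.integral_sub _ (by simp), integral_ite_lt ht.1 a.2.1]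
      · simp [a.2.1]; ring
      · exact (intervalIntegrable_const (c := (1 : ℝ))).mono_fun
          (measurable_ite_lt _).aestronglyMeasurable
          (Filter.Eventually.of_forall fun x => by dsimp only; split_ifs <;> simp)
    · simp [h]

/-- The jump of the slope at `a` evaluates `g` there, and the slopes at the ends give the linear
interpolation of the end values. So the Laplacian of the tent is `δ_a` minus a probability measure
on the end points of the edge. -/
lemma energy_tent [Fintype E] {G : MetricGraph V E} (e : E) (a : Icc (0 : ℝ) (G.len e))
    {g : G.Point → ℝ} (hg : G.MemH1 g) :
    G.energy (G.tent e a) g = g (G.edgePoint e a) -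
      ((1 - a / G.len e) * g (G.vertex (G.src e)) + a / G.len e * g (G.vertex (G.tgt e))) := by
  classical
  rw [(G.tent_hasGrad e a).energy_eq hg.hasGrad, Finset.sum_eq_single e]
  · have h := hg.hasGrad
    have hi : IntegrableOn (G.grad g e) (Ioo 0 (G.len e)) := (h.memLp e).integrable (by norm_num)
    have h1 : ∫ x in Ioo 0 (G.len e), (if x < (a : ℝ) then 1 else 0) * G.grad g e x
        = g (G.edgePoint e a) - g (G.vertex (G.src e)) := by
      rw [integral_Ioo_ite_lt_mul, min_eq_right a.2.2, ← intervalIntegral_eq_integral_Ioo a.2.1,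
        ← edgePoint_zero, h.sub_eq]
    simp only [if_true, sub_mul]
    rw [integral_sub _ (hi.const_mul _), h1, integral_const_mul, vertex_sub_vertex h]
    · ring
    · refine hi.bdd_mul (c := 1) (measurable_ite_lt _).aestronglyMeasurable
        (Filter.Eventually.of_forall fun x => by split_ifs <;> simp)
  · intro e' _ h
    simp [h]
  · simp

/-- Functions in the Sobolev space separate points. -/
lemma eq_of_forall_memH1_eq (G : MetricGraph V E) {x y : G.Point}
    (h : ∀ g, G.MemH1 g → g x = g y) : x = y := by
  classical
  -- A tent with an interior apex attains its maximum only at the apex, so it separates the apex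
  -- from every other point.
  have key : ∀ e (a : Icc (0 : ℝ) (G.len e)), 0 < (a : ℝ) → (a : ℝ) < G.len e → ∀ z,
      G.tent e a (G.edgePoint e a) = G.tent e a z → G.edgePoint e a = z := by
    intro e a h0 h1 z hz
    have hl := G.len_pos e
    have hq : 0 < 1 - a / G.len e := by rw [sub_pos, div_lt_one hl]; exact h1
    rw [tent_edgePoint, if_pos rfl, min_self] at hz
    have hpos : 0 < a - a / G.len e * (a : ℝ) := by
      have := mul_pos h0 hq; linarith
    rcases G.point_cases z with ⟨v, rfl⟩ | ⟨e', t, rfl⟩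
    · rw [tent_vertex] at hz
      exact absurd hz hpos.ne'
    · rw [tent_edgePoint] at hz
      split_ifs at hz with hee
      · subst hee
        congr 1
        ext
        rcases lt_trichotomy (a : ℝ) t with hlt | heq | hgt
        · rw [min_eq_right hlt.le] at hz
          have : 0 < a / G.len e' := div_pos h0 hl
          nlinarith
        · exact heq
        · rw [min_eq_left hgt.le] at hz
          nlinarith
      · exact absurd hz hpos.ne'
  rcases G.point_cases_interior x with ⟨u, rfl⟩ | ⟨e, a, h0, h1, rfl⟩
  · rcases G.point_cases_interior y with ⟨v, rfl⟩ | ⟨e, a, h0, h1, rfl⟩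
    · have := h _ (G.vertexFun_hasGrad (Pi.single u 1)).memH1
      rw [vertexFun_vertex, vertexFun_vertex, Pi.single_eq_same] at this
      by_cases huv : v = u
      · rw [huv]
      · rw [Pi.single_eq_of_ne huv] at this
        norm_num at this
    · exact (key e a h0 h1 _ (h _ (G.tent_hasGrad e a).memH1).symm).symm
  · exact key e a h0 h1 _ (h _ (G.tent_hasGrad e a).memH1)

/-! ### Existence of potentials -/

section Potential

variable [Fintype E]

lemma energy_vertexFun_eq {G : MetricGraph V E} (c : V → ℝ) {g : G.Point → ℝ} (hg : G.MemH1 g) :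
    G.energy (G.vertexFun c) g =
      G.energy (G.vertexFun c) (G.vertexFun fun v => g (G.vertex v)) := by
  rw [energy_vertexFun c hg, energy_vertexFun c (G.vertexFun_hasGrad _).memH1]
  rfl

/-- The discrete Poisson equation is solvable. -/
lemma exists_energy_vertexFun_eq [Finite V] (G : MetricGraph V E) (l : (V → ℝ) →ₗ[ℝ] ℝ)
    (hl : l (fun _ => 1) = 0) :
    ∃ c : V → ℝ, ∀ g, G.MemH1 g → G.energy (G.vertexFun c) g = l fun v => g (G.vertex v) := by
  obtain ⟨v₀⟩ := G.nonempty
  have hB : ∀ c d : V → ℝ, G.energy (G.vertexFun c) (G.vertexFun d)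
      = ∑ e, (c (G.tgt e) - c (G.src e)) / G.len e * (d (G.tgt e) - d (G.src e)) :=
    fun c d => energy_vertexFun c (G.vertexFun_hasGrad d).memH1
  -- The rank-one term `c v₀ * d v₀` removes the constants from the kernel of the discrete
  -- Laplacian; the form becomes positive definite, hence nondegenerate.
  let B : (V → ℝ) →ₗ[ℝ] Module.Dual ℝ (V → ℝ) := LinearMap.mk₂ ℝ
    (fun c d => G.energy (G.vertexFun c) (G.vertexFun d) + c v₀ * d v₀)
    (fun c c' d => by
      simp only [hB, Pi.add_apply]
      rw [add_add_add_comm, ← Finset.sum_add_distrib]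
      congr 1
      · exact Finset.sum_congr rfl fun e _ => by ring
      · ring)
    (fun a c d => by
      simp only [hB, Pi.smul_apply, smul_eq_mul]
      rw [mul_add, Finset.mul_sum]
      congr 1
      · exact Finset.sum_congr rfl fun e _ => by ring
      · ring)
    (fun c d d' => by
      simp only [hB, Pi.add_apply]
      rw [add_add_add_comm, ← Finset.sum_add_distrib]
      congr 1
      · exact Finset.sum_congr rfl fun e _ => by ring
      · ring)
    (fun a c d => by
      simp only [hB, Pi.smul_apply, smul_eq_mul]
      rw [mul_add, Finset.mul_sum]
      congr 1
      · exact Finset.sum_congr rfl fun e _ => by ring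
      · ring)
  have hBa : ∀ c d, B c d = G.energy (G.vertexFun c) (G.vertexFun d) + c v₀ * d v₀ :=
    fun _ _ => rfl
  have hinj : Function.Injective B := by
    rw [injective_iff_map_eq_zero]
    intro c hc
    have h1 : B c c = 0 := by rw [hc]; rfl
    rw [hBa] at h1
    have h2 := G.energy_self_nonneg (G.vertexFun c)
    have h3 := mul_self_nonneg (c v₀)
    have h4 : c v₀ = 0 := mul_self_eq_zero.1 (by linarith)
    ext v
    have := eq_of_energy_eq_zero (G.vertexFun_hasGrad c).memH1 (by linarith)
      (G.vertex v) (G.vertex v₀)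
    rw [vertexFun_vertex, vertexFun_vertex, h4] at this
    exact this
  have hsurj : Function.Surjective B :=
    (LinearMap.injective_iff_surjective_of_finrank_eq_finrank Subspace.dual_finrank_eq.symm).1 hinj
  obtain ⟨c, hc⟩ := hsurj l
  refine ⟨c, fun g hg => ?_⟩
  -- Testing with the constant `1`, on which both `l` and the energy vanish, gives `c v₀ = 0`, so
  -- the added term disappears.
  have h1 : B c (fun _ => 1) = 0 := by rw [hc, hl]
  rw [hBa, hB] at h1
  have h0 : c v₀ = 0 := by simpa using h1
  rw [energy_vertexFun_eq c hg, ← hc, hBa, h0, zero_mul, add_zero]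

/-- A tent sweeps the unit charge at `x` to the vertices; `l` is the swept charge, of total mass
`1`. -/
lemma exists_energy_eq_sub (G : MetricGraph V E) (x : G.Point) :
    ∃ τ, G.MemH1 τ ∧ ∃ l : (V → ℝ) →ₗ[ℝ] ℝ, l (fun _ => 1) = 1 ∧
      ∀ g, G.MemH1 g → G.energy τ g = g x - l fun v => g (G.vertex v) := by
  rcases G.point_cases x with ⟨v, rfl⟩ | ⟨e, t, rfl⟩
  · refine ⟨fun _ => 0, G.memH1_const 0, LinearMap.proj v, rfl, fun g hg => ?_⟩
    rw [energy_const_left 0 hg]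
    simp
  · refine ⟨G.tent e t, (G.tent_hasGrad e t).memH1,
      (1 - t / G.len e) • LinearMap.proj (G.src e) + (t / G.len e : ℝ) • LinearMap.proj (G.tgt e),
      by simp, fun g hg => ?_⟩
    rw [energy_tent e t hg]
    simp

/-- After both charges are swept to the vertices, the remaining charge `l - l'` has total mass zero,
and an edgewise affine function solves the Poisson equation for it. -/
lemma exists_isPotential [Finite V] (G : MetricGraph V E) (x y : G.Point) : ∃ f, G.IsPotential x y f := by
  obtain ⟨τ, hτ, l, hl, h⟩ := G.exists_energy_eq_sub x
  obtain ⟨τ', hτ', l', hl', h'⟩ := G.exists_energy_eq_sub y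
  obtain ⟨c, hc⟩ := G.exists_energy_vertexFun_eq (l - l') (by simp [hl, hl'])
  have hcm := (G.vertexFun_hasGrad c).memH1
  set F := τ - τ' + G.vertexFun c with hF
  have hFm : G.MemH1 F := (hτ.sub hτ').add hcm
  refine ⟨F - fun _ => F y, hFm.sub (G.memH1_const _), fun g hg => ?_, by simp⟩
  rw [energy_sub_const_left _ hFm hg, hF, energy_add_left (hτ.sub hτ') hcm hg,
    energy_sub_left hτ hτ' hg, h g hg, h' g hg, hc g hg, LinearMap.sub_apply]
  ring

end Potential

end MetricGraph

namespace MetricGraph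

variable {V E : Type*} [Fintype E] {G : MetricGraph V E}

/-! ### The effective resistance -/

lemma IsPotential.energy_self {x y : G.Point} {h : G.Point → ℝ} (hh : G.IsPotential x y h) :
    G.energy h h = h x := by
  rw [hh.2.1 h hh.1, hh.2.2, sub_zero]

lemma IsPotential.eq {x y : G.Point} {h h' : G.Point → ℝ} (hh : G.IsPotential x y h)
    (hh' : G.IsPotential x y h') : h = h' := by
  have hm := hh.1.sub hh'.1
  have h0 : G.energy (h - h') (h - h') = 0 := by
    rw [energy_sub_left hh.1 hh'.1 hm, hh.2.1 _ hm, hh'.2.1 _ hm, sub_self]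
  ext z
  have := eq_of_energy_eq_zero hm h0 z y
  simp only [Pi.sub_apply, hh.2.2, hh'.2.2, sub_self] at this
  exact sub_eq_zero.1 this

lemma IsPotential.resistance_eq {x y : G.Point} {h : G.Point → ℝ} (hh : G.IsPotential x y h) :
    G.resistance x y = h x := by
  have hex : ∃ f, G.IsPotential x y f := ⟨h, hh⟩
  rw [resistance, dif_pos hex, hex.choose_spec.eq hh]

lemma IsPotential.symm {x y : G.Point} {h : G.Point → ℝ} (hh : G.IsPotential x y h) :
    G.IsPotential y x ((-1 : ℝ) • (h - fun _ => h x)) := by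
  have hm := hh.1.sub (G.memH1_const (h x))
  refine ⟨hm.smul _, fun g hg => ?_, by simp⟩
  rw [energy_smul_left _ hm hg, energy_sub_const_left _ hh.1 hg, hh.2.1 g hg]
  ring

lemma resistance_self (G : MetricGraph V E) (x : G.Point) : G.resistance x x = 0 := by
  have : G.IsPotential x x fun _ => 0 :=
    ⟨G.memH1_const 0, fun g hg => by rw [energy_const_left 0 hg, sub_self], rfl⟩
  rw [this.resistance_eq]

variable [Finite V]

lemma resistance_nonneg (G : MetricGraph V E) (x y : G.Point) : 0 ≤ G.resistance x y := by
  obtain ⟨h, hh⟩ := G.exists_isPotential x y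
  rw [hh.resistance_eq, ← hh.energy_self]
  exact G.energy_self_nonneg h

/-- The resistance controls the oscillation of functions of finite energy. -/
lemma sq_sub_le_resistance_mul_energy {f : G.Point → ℝ} (hf : G.MemH1 f) (x y : G.Point) :
    (f x - f y) ^ 2 ≤ G.resistance x y * G.energy f f := by
  obtain ⟨h, hh⟩ := G.exists_isPotential x y
  -- The difference is the pairing of `f` with the potential `h`, and `h` has energy `r(x, y)`:
  -- Cauchy–Schwarz.
  rw [← hh.2.1 f hf, hh.resistance_eq, ← hh.energy_self]
  exact energy_sq_le hh.1 hf

lemma abs_sub_le_sqrt_resistance_mul {f : G.Point → ℝ} (hf : G.MemH1 f) (x y : G.Point) :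
    |f x - f y| ≤ √(G.resistance x y) * √(G.energy f f) := by
  rw [← Real.sqrt_mul (G.resistance_nonneg x y)]
  exact Real.abs_le_sqrt (sq_sub_le_resistance_mul_energy hf x y)

/-- The potential `h` of `x, z` has energy `r(x, z) = (h x - h y) + (h y - h z)`. Bounding both
differences and dividing by `√r(x, z)` gives the claim. This weak form of the triangle inequality
for `r` suffices for continuity. -/
lemma sqrt_resistance_triangle (G : MetricGraph V E) (x y z : G.Point) :
    √(G.resistance x z) ≤ √(G.resistance x y) + √(G.resistance y z) := by
  obtain ⟨h, hh⟩ := G.exists_isPotential x z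
  have h1 := abs_sub_le_sqrt_resistance_mul hh.1 x y
  have h2 := abs_sub_le_sqrt_resistance_mul hh.1 y z
  have h3 : √(G.resistance x z) * √(G.resistance x z) = (h x - h y) + (h y - h z) := by
    rw [Real.mul_self_sqrt (G.resistance_nonneg x z), hh.resistance_eq, hh.2.2]; ring
  have hE : G.energy h h = G.resistance x z := by rw [hh.energy_self, hh.resistance_eq]
  rw [hE] at h1 h2
  rcases (Real.sqrt_nonneg (G.resistance x z)).eq_or_lt with h0 | h0
  · rw [← h0]; positivity
  · refine le_of_mul_le_mul_right ?_ h0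
    rw [h3, add_mul]
    exact add_le_add ((le_abs_self _).trans h1) ((le_abs_self _).trans h2)

lemma resistance_comm (G : MetricGraph V E) (x y : G.Point) :
    G.resistance x y = G.resistance y x := by
  obtain ⟨h, hh⟩ := G.exists_isPotential x y
  rw [hh.symm.resistance_eq, hh.resistance_eq]
  simp [hh.2.2]

/-- The Sobolev inequality for the potential itself reads `r² ≤ |s - t| r`. -/
lemma resistance_edgePoint_le (G : MetricGraph V E) (e : E) (s t : Icc (0 : ℝ) (G.len e)) :
    G.resistance (G.edgePoint e s) (G.edgePoint e t) ≤ |(s : ℝ) - t| := by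
  obtain ⟨h, hh⟩ := G.exists_isPotential (G.edgePoint e s) (G.edgePoint e t)
  have h1 := sq_sub_le_abs_mul_energy hh.1 e s t
  rw [hh.energy_self, hh.2.2, sub_zero, ← hh.resistance_eq] at h1
  rcases (G.resistance_nonneg (G.edgePoint e s) (G.edgePoint e t)).eq_or_lt with h0 | h0
  · rw [← h0]; exact abs_nonneg _
  · rw [sq] at h1
    exact le_of_mul_le_mul_right h1 h0

lemma eq_of_resistance_eq_zero {x y : G.Point} (h : G.resistance x y = 0) : x = y := by
  refine G.eq_of_forall_memH1_eq fun g hg => ?_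
  have := sq_sub_le_resistance_mul_energy hg x y
  rw [h, zero_mul] at this
  exact sub_eq_zero.1 (pow_eq_zero_iff two_ne_zero |>.1 (le_antisymm this (sq_nonneg _)))

lemma continuous_sqrt_resistance_left (G : MetricGraph V E) (y : G.Point) :
    Continuous fun x => √(G.resistance x y) := by
  rw [G.continuous_iff_edgewise]
  intro e
  rw [continuous_iff_continuousAt]
  intro s
  have hb : ∀ t : Icc (0 : ℝ) (G.len e), dist √(G.resistance (G.edgePoint e t) y)
      √(G.resistance (G.edgePoint e s) y) ≤ √|(t : ℝ) - s| := by
    intro t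
    have h0 := Real.sqrt_le_sqrt (G.resistance_edgePoint_le e t s)
    have h1 := G.sqrt_resistance_triangle (G.edgePoint e t) (G.edgePoint e s) y
    have h2 := G.sqrt_resistance_triangle (G.edgePoint e s) (G.edgePoint e t) y
    rw [G.resistance_comm (G.edgePoint e s) (G.edgePoint e t)] at h2
    rw [Real.dist_eq, abs_le]
    constructor <;> linarith
  have hl : Continuous fun t : Icc (0 : ℝ) (G.len e) => √|(t : ℝ) - s| := by fun_prop
  have h0 := hl.tendsto s
  simp only [sub_self, abs_zero, Real.sqrt_zero] at h0
  exact tendsto_iff_dist_tendsto_zero.2 (squeeze_zero (fun _ => dist_nonneg) hb h0)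

/-- The triangle inequality bounds the change of `√r` by `√r(x', x) + √r(y', y)`, which reduces
joint continuity to continuity in one variable. -/
lemma continuous_resistance (G : MetricGraph V E) :
    Continuous fun p : G.Point × G.Point => G.resistance p.1 p.2 := by
  have hs : Continuous fun p : G.Point × G.Point => √(G.resistance p.1 p.2) := by
    rw [continuous_iff_continuousAt]
    rintro ⟨x, y⟩
    have hb : ∀ p : G.Point × G.Point, dist √(G.resistance p.1 p.2) √(G.resistance x y)
        ≤ √(G.resistance p.1 x) + √(G.resistance p.2 y) := by
      rintro ⟨x', y'⟩
      have h1 := G.sqrt_resistance_triangle x' x y'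
      have h2 := G.sqrt_resistance_triangle x y y'
      have h3 := G.sqrt_resistance_triangle x x' y
      have h4 := G.sqrt_resistance_triangle x' y' y
      rw [G.resistance_comm y y'] at h2
      rw [G.resistance_comm x x'] at h3
      rw [Real.dist_eq, abs_le]
      constructor <;> simp only <;> linarith
    have hl : Continuous fun p : G.Point × G.Point =>
        √(G.resistance p.1 x) + √(G.resistance p.2 y) :=
      ((G.continuous_sqrt_resistance_left x).comp continuous_fst).add
        ((G.continuous_sqrt_resistance_left y).comp continuous_snd)
    have h0 := hl.tendsto (x, y)
    simp only [resistance_self, Real.sqrt_zero, add_zero] at h0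
    exact tendsto_iff_dist_tendsto_zero.2 (squeeze_zero (fun _ => dist_nonneg) hb h0)
  have := hs.pow 2
  exact this.congr fun p => Real.sq_sqrt (G.resistance_nonneg _ _)

lemma isGreatest_resistanceDiam (G : MetricGraph V E) :
    IsGreatest (range fun p : G.Point × G.Point => G.resistance p.1 p.2) G.resistanceDiam :=
  (isCompact_range G.continuous_resistance).isGreatest_sSup (range_nonempty _)

lemma resistance_le_diam (G : MetricGraph V E) (x y : G.Point) :
    G.resistance x y ≤ G.resistanceDiam := G.isGreatest_resistanceDiam.2 ⟨(x, y), rfl⟩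

lemma exists_resistance_eq_diam (G : MetricGraph V E) :
    ∃ x y, G.resistance x y = G.resistanceDiam :=
  let ⟨⟨x, y⟩, h⟩ := G.isGreatest_resistanceDiam.1
  ⟨x, y, h⟩

lemma resistanceDiam_nonneg (G : MetricGraph V E) : 0 ≤ G.resistanceDiam := by
  obtain ⟨x, y, h⟩ := G.exists_resistance_eq_diam
  exact h ▸ G.resistance_nonneg x y

lemma subsingleton_point_of_resistanceDiam_eq_zero (h : G.resistanceDiam = 0) :
    Subsingleton G.Point :=
  ⟨fun x y => eq_of_resistance_eq_zero
    (le_antisymm (h ▸ G.resistance_le_diam x y) (G.resistance_nonneg x y))⟩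

lemma resistanceDiam_pos (G : MetricGraph V E) (h : Nonempty E) : 0 < G.resistanceDiam := by
  refine G.resistanceDiam_nonneg.lt_of_ne fun h0 => ?_
  obtain ⟨e⟩ := h
  have hs := subsingleton_point_of_resistanceDiam_eq_zero h0.symm
  have hl := G.len_pos e
  have ha : G.len e / 2 ∈ Icc 0 (G.len e) := ⟨by linarith, by linarith⟩
  have h1 := congrArg (G.tent e ⟨_, ha⟩)
    (hs.elim (G.edgePoint e ⟨_, ha⟩) (G.vertex (G.src e)))
  rw [tent_vertex, tent_edgePoint, if_pos rfl, min_self] at h1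
  dsimp only at h1
  field_simp at h1
  linarith

end MetricGraph

namespace MetricGraph

variable {V E : Type*} {G : MetricGraph V E}

/-! ### Two-point measures -/

instance instIsProbabilityMeasureTwoPoint (G : MetricGraph V E) (x y : G.Point) :
    IsProbabilityMeasure (G.twoPointMeasure x y) := by
  refine ⟨?_⟩
  simp only [twoPointMeasure, Measure.smul_apply, Measure.add_apply, measure_univ, smul_eq_mul]
  rw [one_add_one_eq_two, ENNReal.inv_mul_cancel two_ne_zero ENNReal.ofNat_ne_top]

lemma integral_twoPointMeasure (x y : G.Point) {f : G.Point → ℝ} (hf : Continuous f) :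
    ∫ z, f z ∂(G.twoPointMeasure x y) = (f x + f y) / 2 := by
  have hi : ∀ z, Integrable f (Measure.dirac z) := fun z =>
    integrable_dirac' hf.stronglyMeasurable (by simp)
  rw [twoPointMeasure, integral_smul_measure, integral_add_measure (hi x) (hi y),
    integral_dirac' _ _ hf.stronglyMeasurable, integral_dirac' _ _ hf.stronglyMeasurable]
  simp
  ring

lemma mem_support_twoPointMeasure (x y : G.Point) :
    x ∈ (G.twoPointMeasure x y).support ∧ y ∈ (G.twoPointMeasure x y).support := by
  simp only [Measure.mem_support_iff_forall]
  have key : ∀ z : G.Point, ∀ U ∈ 𝓝 z, Measure.dirac z U = 1 :=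
    fun z U hU => Measure.dirac_apply_of_mem (mem_of_mem_nhds hU)
  constructor <;> intro U hU <;>
    simp [twoPointMeasure, key _ U hU, pos_iff_ne_zero]

variable [Fintype E]

/-! ### Eigenfunctions -/

section Eigenfunctions

variable {μ : Measure G.Point} {b : ℝ} {f : G.Point → ℝ}

lemma memH1Measure_const (μ : Measure G.Point) (c : ℝ) : G.MemH1Measure μ fun _ => c :=
  ⟨G.memH1_const c, fun _ hg _ => energy_const_left c hg⟩

lemma IsEigenfunction.memH1 (h : G.IsEigenfunction μ b f) : G.MemH1 f := h.2.1.1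

lemma IsEigenfunction.energy_self (h : G.IsEigenfunction μ b f) :
    G.energy f f = b * ∫ x, f x ^ 2 ∂μ := by
  rw [h.2.2.2 f h.2.1, ← integral_const_mul]
  congr 1; ext x; simp only [Pi.smul_apply, smul_eq_mul]; ring

lemma IsEigenfunction.mul_integral_eq_zero (h : G.IsEigenfunction μ b f) :
    b * ∫ x, f x ∂μ = 0 := by
  have h1 := h.2.2.2 _ (G.memH1Measure_const μ 1)
  rw [energy_comm, energy_const_left 1 h.memH1] at h1
  rw [← integral_const_mul, h1]
  simp

/-- If all these eigenfunctions were constant, their span would have rank at most one. -/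
lemma exists_nonconst_eigenfunction {a : ℝ}
    (h : ((1 + 1 : ℕ) : Cardinal) ≤ Module.rank ℝ (G.lowEigenspace μ a)) :
    ∃ b ≤ a, ∃ f, G.IsEigenfunction μ b f ∧ ∃ x y, f x ≠ f y := by
  by_contra! hc
  obtain ⟨x₀⟩ : Nonempty G.Point := inferInstance
  have hle : G.lowEigenspace μ a ≤ Submodule.span ℝ {fun _ => (1 : ℝ)} := by
    refine Submodule.span_le.2 ?_
    rintro f ⟨b, hb, hf⟩
    refine Submodule.mem_span_singleton.2 ⟨f x₀, ?_⟩
    ext x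
    simp [hc b hb f hf x x₀]
  have h1 := (Submodule.rank_mono hle).trans (rank_span_le _)
  rw [Cardinal.mk_singleton] at h1
  have := h.trans h1
  norm_cast at this

/-- A nonconstant eigenfunction, normalized to unit energy. -/
lemma exists_normalized_eigenfunction {a : ℝ}
    (h : ((1 + 1 : ℕ) : Cardinal) ≤ Module.rank ℝ (G.lowEigenspace μ a)) :
    ∃ f, G.MemH1 f ∧ G.energy f f = 1 ∧ ∫ x, f x ∂μ = 0 ∧ 1 ≤ a * ∫ x, f x ^ 2 ∂μ := by
  obtain ⟨b, hb, f, hf, x, y, hxy⟩ := exists_nonconst_eigenfunction h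
  have hE : 0 < G.energy f f :=
    (G.energy_self_nonneg f).lt_of_ne fun h0 => hxy (eq_of_energy_eq_zero hf.memH1 h0.symm x y)
  -- A nonzero eigenvalue makes the eigenfunction orthogonal to the constants, which yields mean
  -- zero below.
  have hb0 : b ≠ 0 := by
    rintro rfl
    rw [hf.energy_self, zero_mul] at hE
    exact hE.false
  set s := (√(G.energy f f))⁻¹ with hs
  have hs2 : s * s * G.energy f f = 1 := by
    rw [hs, ← mul_inv, Real.mul_self_sqrt hE.le, inv_mul_cancel₀ hE.ne']
  refine ⟨s • f, hf.memH1.smul s, ?_, ?_, ?_⟩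
  · rw [energy_smul_left s hf.memH1 (hf.memH1.smul s), energy_smul_right s hf.memH1 hf.memH1,
      ← hs2]
    ring
  · simp only [Pi.smul_apply, smul_eq_mul]
    rw [integral_const_mul, (mul_eq_zero.1 hf.mul_integral_eq_zero).resolve_left hb0, mul_zero]
  · simp only [Pi.smul_apply, smul_eq_mul, mul_pow]
    rw [integral_const_mul]
    have hI : 0 ≤ ∫ x, f x ^ 2 ∂μ := integral_nonneg fun _ => sq_nonneg _
    calc (1 : ℝ) = s ^ 2 * (b * ∫ x, f x ^ 2 ∂μ) := by rw [← hf.energy_self, ← hs2]; ring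
      _ ≤ s ^ 2 * (a * ∫ x, f x ^ 2 ∂μ) := by gcongr
      _ = _ := by ring

variable [Finite V]

lemma integrable_of_continuous [IsFiniteMeasure μ] (hf : Continuous f) : Integrable f μ := by
  obtain ⟨C, hC⟩ := isCompact_univ.exists_bound_of_continuousOn hf.continuousOn
  exact Integrable.of_bound hf.aestronglyMeasurable C (Filter.Eventually.of_forall fun x => hC x
    (mem_univ x))

/-- The variance of a continuous function is at most the product of the distances of its mean to
its extremal values. -/
lemma exists_integral_sq_le [IsProbabilityMeasure μ] (hf : Continuous f)
    (h0 : ∫ x, f x ∂μ = 0) : ∃ x y, f y ≤ f x ∧ ∫ z, f z ^ 2 ∂μ ≤ -(f x * f y) := by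
  obtain ⟨x, -, hx⟩ := isCompact_univ.exists_isMaxOn univ_nonempty hf.continuousOn
  obtain ⟨y, -, hy⟩ := isCompact_univ.exists_isMinOn univ_nonempty hf.continuousOn
  refine ⟨x, y, hx (mem_univ y), ?_⟩
  have hi := integrable_of_continuous (μ := μ) hf
  -- Integrate `(f x - f z) * (f z - f y) ≥ 0`; the linear term vanishes because the mean is zero.
  calc ∫ z, f z ^ 2 ∂μ ≤ ∫ z, ((f x + f y) * f z - f x * f y) ∂μ := by
        refine integral_mono (integrable_of_continuous (hf.pow 2))
          ((hi.const_mul _).sub (integrable_const _)) fun z => ?_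
        have h1 : f z ≤ f x := hx (mem_univ z)
        have h2 : f y ≤ f z := hy (mem_univ z)
        have := mul_nonneg (sub_nonneg.2 h1) (sub_nonneg.2 h2)
        simp only
        nlinarith
    _ = -(f x * f y) := by
        rw [integral_sub (hi.const_mul _) (integrable_const _), integral_const_mul, h0]
        simp

/-- With `M`, `m` the extreme values of a normalized eigenfunction, `4 ∫ f² ≤ -4 M m ≤ (M - m)² ≤
r(x, y) ≤ D`, while `1 ≤ a ∫ f²`. -/
lemma four_le_mul_resistanceDiam [IsProbabilityMeasure μ] {a : ℝ} (ha : 0 ≤ a)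
    (h : ((1 + 1 : ℕ) : Cardinal) ≤ Module.rank ℝ (G.lowEigenspace μ a)) :
    4 ≤ a * G.resistanceDiam := by
  obtain ⟨f, hf, hE, h0, h1⟩ := exists_normalized_eigenfunction h
  obtain ⟨x, y, -, hxy⟩ := exists_integral_sq_le hf.1 h0
  have h2 := sq_sub_le_resistance_mul_energy hf x y
  rw [hE, mul_one] at h2
  have h3 := G.resistance_le_diam x y
  have h4 : 4 * ∫ z, f z ^ 2 ∂μ ≤ G.resistanceDiam := by nlinarith [sq_nonneg (f x + f y)]
  nlinarith [mul_le_mul_of_nonneg_left h4 ha]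

lemma le_eigenvalue_one (G : MetricGraph V E) (μ : Measure G.Point) [IsProbabilityMeasure μ] :
    4 / ENNReal.ofReal G.resistanceDiam ≤ G.eigenvalue 1 μ := by
  refine le_iInf₂ fun a ha => ENNReal.div_le_of_le_mul ?_
  have h := four_le_mul_resistanceDiam a.2 ha
  rw [← ENNReal.ofReal_coe_nnreal, ← ENNReal.ofReal_mul a.coe_nonneg, ← ENNReal.ofReal_ofNat]
  exact ENNReal.ofReal_le_ofReal h

end Eigenfunctions

/-! ### The optimal eigenvalue -/

variable [Finite V]

lemma eigenvalue_one_twoPointMeasure_le {x y : G.Point} (hxy : 0 < G.resistance x y) :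
    G.eigenvalue 1 (G.twoPointMeasure x y) ≤ 4 / ENNReal.ofReal (G.resistance x y) := by
  set μ := G.twoPointMeasure x y with hμ
  set r := G.resistance x y with hr
  obtain ⟨h, hh⟩ := G.exists_isPotential x y
  have hx : h x = r := by rw [hr, hh.resistance_eq]
  -- The shift by `r / 2` gives the values `± r / 2` at the two atoms, so `φ x - φ y` equals the
  -- integral of `(4 / r) f φ` against the two-point measure.
  set f : G.Point → ℝ := h - fun _ => r / 2 with hf
  have hfm : G.MemH1 f := hh.1.sub (G.memH1_const _)
  have hfx : f x = r / 2 := by simp [hf, hx]; ring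
  have hfy : f y = -(r / 2) := by simp [hf, hh.2.2]
  have hfE : ∀ g, G.MemH1 g → G.energy f g = g x - g y := fun g hg => by
    rw [hf, energy_sub_const_left _ hh.1 hg, hh.2.1 g hg]
  have hmem : ∀ {g : G.Point → ℝ}, Continuous g → MemLp g 2 μ := fun {g} hg => by
    obtain ⟨C, hC⟩ := isCompact_univ.exists_bound_of_continuousOn hg.continuousOn
    exact MemLp.of_bound hg.aestronglyMeasurable C
      (Filter.Eventually.of_forall fun z => hC z (mem_univ z))
  have hfeig : G.IsEigenfunction μ (4 / r) f := by
    refine ⟨fun h0 => ?_, ⟨hfm, fun g hg hg0 => ?_⟩, hmem (hfm.smul _).1, fun φ hφ => ?_⟩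
    · rw [h0] at hfx
      simp at hfx; linarith
    · rw [compl_compl] at hg0
      rw [hfE g hg, hg0 x (mem_support_twoPointMeasure x y).1,
        hg0 y (mem_support_twoPointMeasure x y).2, sub_self]
    · rw [hfE φ hφ.1, integral_twoPointMeasure x y (f := fun z => ((4 / r) • f) z * φ z)
        ((hfm.smul _).1.mul hφ.1.1)]
      simp only [Pi.smul_apply, smul_eq_mul, hfx, hfy]
      field_simp; ring
  have h1eig : G.IsEigenfunction μ 0 fun _ => 1 := by
    refine ⟨fun h0 => one_ne_zero (congrFun h0 x), G.memH1Measure_const μ 1, ?_, fun φ hφ => ?_⟩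
    · rw [zero_smul]; exact MemLp.zero'
    · rw [energy_const_left 1 hφ.1]; simp
  have h4r : 0 ≤ 4 / r := by positivity
  have hrank : ((1 + 1 : ℕ) : Cardinal) ≤
      Module.rank ℝ (G.lowEigenspace μ ((4 / r).toNNReal : ℝ)) := by
    rw [Real.coe_toNNReal _ h4r]
    have hli : LinearIndependent ℝ ![f, fun _ => 1] := by
      rw [LinearIndependent.pair_iff]
      intro s t hst
      have e1 := congrFun hst x
      have e2 := congrFun hst y
      simp only [Pi.add_apply, Pi.smul_apply, smul_eq_mul, hfx, hfy, Pi.zero_apply] at e1 e2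
      have : s * r = 0 := by linarith
      have hs : s = 0 := (mul_eq_zero.1 this).resolve_right hxy.ne'
      subst hs
      exact ⟨rfl, by linarith⟩
    have hle : Submodule.span ℝ (range ![f, fun _ => 1]) ≤ G.lowEigenspace μ (4 / r) := by
      refine Submodule.span_mono ?_
      rintro _ ⟨i, rfl⟩
      fin_cases i
      · exact ⟨4 / r, le_refl _, hfeig⟩
      · exact ⟨0, h4r, h1eig⟩
    have := Submodule.rank_mono hle
    have hc : Cardinal.mk (range ![f, fun _ => 1]) = 2 := by
      simpa using Cardinal.mk_range_eq_of_injective hli.injective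
    rw [rank_span hli, hc] at this
    exact_mod_cast this
  unfold eigenvalue
  refine iInf₂_le_of_le (4 / r).toNNReal hrank (le_of_eq ?_)
  change ENNReal.ofReal (4 / r) = _
  rw [ENNReal.ofReal_div_of_pos hxy, ENNReal.ofReal_ofNat]

lemma eigenvalue_one_twoPointMeasure {x y : G.Point} (hxy : G.resistance x y = G.resistanceDiam) :
    G.eigenvalue 1 (G.twoPointMeasure x y) = 4 / ENNReal.ofReal G.resistanceDiam := by
  refine le_antisymm ?_ (G.le_eigenvalue_one _)
  rcases G.resistanceDiam_nonneg.eq_or_lt with h0 | h0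
  -- For a single point the bound is `4 / 0 = ∞`.
  · rw [← h0, ENNReal.ofReal_zero, ENNReal.div_zero (four_ne_zero (α := ℝ≥0∞))]; exact le_top
  · rw [← hxy] at h0 ⊢
    exact eigenvalue_one_twoPointMeasure_le h0

lemma optimalEigenvalue_one (G : MetricGraph V E) :
    G.optimalEigenvalue 1 = 4 / ENNReal.ofReal G.resistanceDiam := by
  refine le_antisymm ?_ (le_iInf fun μ => G.le_eigenvalue_one μ)
  obtain ⟨x, y, hxy⟩ := G.exists_resistance_eq_diam
  rw [← eigenvalue_one_twoPointMeasure hxy]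
  exact iInf_le (fun μ : ProbabilityMeasure G.Point => G.eigenvalue 1 (μ : Measure G.Point))
    ⟨G.twoPointMeasure x y, inferInstance⟩

end MetricGraph

namespace MetricGraph

variable {V E : Type*} [Fintype E] {G : MetricGraph V E}

/-! ### Optimal measures -/

/-- Used with `c = 1` to identify two potentials, and with `c = 1 / √D` to show that near-optimal
functions approach a multiple of a potential. -/
lemma energy_sub_smul {f h : G.Point → ℝ} {x y : G.Point} (c : ℝ) (hf : G.MemH1 f)
    (hh : G.IsPotential x y h) :
    G.energy (f - c • h) (f - c • h) =
      G.energy f f - 2 * c * (f x - f y) + c ^ 2 * G.resistance x y := by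
  have hc := hh.1.smul c
  rw [energy_sub_left hf hc (hf.sub hc), energy_sub_right hf hf hc, energy_sub_right hc hf hc,
    energy_smul_left c hh.1 hf, energy_smul_left c hh.1 hc, energy_smul_right c hf hh.1,
    energy_smul_right c hh.1 hh.1, G.energy_comm f h, hh.2.1 f hf, hh.energy_self,
    hh.resistance_eq]
  ring

variable [Finite V]

/-- For a pair of points at maximal resistance, the potential attains its maximum only at the
source. -/
lemma IsPotential.eq_of_apply_eq_resistanceDiam {x y z : G.Point} {h : G.Point → ℝ}
    (hh : G.IsPotential x y h) (hxy : G.resistance x y = G.resistanceDiam)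
    (hD : 0 < G.resistanceDiam) (hz : h z = G.resistanceDiam) : z = x := by
  -- `h` has energy `D` and differs by `D` between `z` and `y`, which forces `r(z, y) = D`.
  have h1 := sq_sub_le_resistance_mul_energy hh.1 z y
  rw [hh.energy_self, ← hh.resistance_eq, hxy, hh.2.2, hz, sub_zero, sq] at h1
  have h2 : G.resistance z y = G.resistanceDiam :=
    le_antisymm (G.resistance_le_diam z y) (le_of_mul_le_mul_right h1 hD)
  obtain ⟨k, hk⟩ := G.exists_isPotential z y
  have h3 := energy_sub_smul 1 hh.1 hk
  rw [hh.energy_self, ← hh.resistance_eq, hxy, h2, hz, hh.2.2, one_smul] at h3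
  -- The two potentials differ by a function of energy `D - 2D + D = 0`, so `δ_x - δ_z` annihilates
  -- the Sobolev space, which separates points.
  have h4 : G.energy (h - k) (h - k) = 0 := by rw [h3]; ring
  refine G.eq_of_forall_memH1_eq fun g hg => ?_
  have h5 := energy_sq_le (hh.1.sub hk.1) hg
  rw [h4, zero_mul, energy_sub_left hh.1 hk.1 hg, hh.2.1 g hg, hk.2.1 g hg] at h5
  have := pow_eq_zero_iff two_ne_zero |>.1 (le_antisymm h5 (sq_nonneg _))
  linarith

/-- If the first eigenvalue is optimal, then the potential of a suitable pair of points at maximal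
resistance has maximal variance. -/
lemma exists_potential_of_eigenvalue_eq (hD : 0 < G.resistanceDiam) (μ : Measure G.Point)
    [IsProbabilityMeasure μ]
    (hμ : G.eigenvalue 1 μ = 4 / ENNReal.ofReal G.resistanceDiam) :
    ∃ x y h, G.IsPotential x y h ∧ G.resistance x y = G.resistanceDiam ∧
      ∫ z, (h z - G.resistanceDiam / 2) ∂μ = 0 ∧
      G.resistanceDiam ^ 2 / 4 ≤ ∫ z, (h z - G.resistanceDiam / 2) ^ 2 ∂μ := by
  set D := G.resistanceDiam with hDdef
  -- The eigenvalue is defined as an infimum that is not known to be attained here, so normalized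
  -- eigenfunctions for bounds below `4 / D + 1 / (n + 1)` replace a minimizer.
  have hseq : ∀ n : ℕ, ∃ f, G.MemH1 f ∧ G.energy f f = 1 ∧ ∫ z, f z ∂μ = 0 ∧
      1 / (4 / D + 1 / ((n : ℝ) + 1)) ≤ ∫ z, f z ^ 2 ∂μ := by
    intro n
    have hn : (0 : ℝ) < 1 / ((n : ℝ) + 1) := by positivity
    have h4D : (0 : ℝ) < 4 / D := by positivity
    have hlt : G.eigenvalue 1 μ < ENNReal.ofReal (4 / D + 1 / ((n : ℝ) + 1)) := by
      rw [hμ, ← ENNReal.ofReal_ofNat 4, ← ENNReal.ofReal_div_of_pos hD]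
      exact (ENNReal.ofReal_lt_ofReal_iff (by positivity)).2 (by linarith)
    obtain ⟨a, ha⟩ := iInf_lt_iff.1 hlt
    obtain ⟨hrank, ha⟩ := iInf_lt_iff.1 ha
    rw [← ENNReal.ofReal_coe_nnreal, ENNReal.ofReal_lt_ofReal_iff (by positivity)] at ha
    obtain ⟨f, hf, hE, h0, h1⟩ := exists_normalized_eigenfunction hrank
    refine ⟨f, hf, hE, h0, ?_⟩
    have hI : 0 ≤ ∫ z, f z ^ 2 ∂μ := integral_nonneg fun _ => sq_nonneg _
    rw [div_le_iff₀ (by positivity)]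
    nlinarith
  choose f hf hE h0 hI using hseq
  choose p q hqp hpq using fun n => exists_integral_sq_le (μ := μ) (hf n).1 (h0 n)
  -- Along an ultrafilter, the extremal points converge by compactness alone, without passing to
  -- subsequences.
  let U : Ultrafilter ℕ := Filter.hyperfilter ℕ
  have hU : (U : Filter ℕ) ≤ Filter.atTop := Nat.hyperfilter_le_atTop
  set x := (U.map p).lim
  set y := (U.map q).lim
  have hx : Filter.Tendsto p U (𝓝 x) := (U.map p).le_nhds_lim
  have hy : Filter.Tendsto q U (𝓝 y) := (U.map q).le_nhds_lim
  obtain ⟨h, hh⟩ := G.exists_isPotential x y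
  have hlow : Filter.Tendsto (fun n : ℕ => 1 / (4 / D + 1 / ((n : ℝ) + 1))) U (𝓝 (D / 4)) := by
    have h1 : Filter.Tendsto (fun n : ℕ => 1 / (4 / D + 1 / ((n : ℝ) + 1))) Filter.atTop
        (𝓝 (1 / (4 / D + 0))) :=
      tendsto_const_nhds.div (tendsto_const_nhds.add tendsto_one_div_add_atTop_nhds_zero_nat)
        (by positivity)
    rw [add_zero, one_div_div] at h1
    exact h1.mono_left hU
  have hr : ∀ n, (f n (p n) - f n (q n)) ^ 2 ≤ G.resistance (p n) (q n) := fun n => by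
    have := sq_sub_le_resistance_mul_energy (hf n) (p n) (q n)
    rwa [hE n, mul_one] at this
  have hrD : ∀ n, G.resistance (p n) (q n) ≤ D := fun n => G.resistance_le_diam _ _
  have hlow4 := hlow.const_mul 4
  rw [mul_div_cancel₀ D (four_ne_zero)] at hlow4
  -- With `M`, `m` the values at `p n`, `q n`, everything in `-4 M m ≤ (M - m)² ≤ r ≤ D` is squeezed
  -- to `D`. Then `(M + m)² = (M - m)² + 4 M m` tends to zero, so `M` tends to `√D / 2` and `m` to
  -- `-√D / 2`.
  have hprod : Filter.Tendsto (fun n => -(f n (p n) * f n (q n))) U (𝓝 (D / 4)) := by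
    refine tendsto_of_tendsto_of_tendsto_of_le_of_le hlow tendsto_const_nhds
      (fun n => (hI n).trans (hpq n)) fun n => ?_
    have := (hr n).trans (hrD n)
    nlinarith [sq_nonneg (f n (p n) + f n (q n))]
  have hdiff2 : Filter.Tendsto (fun n => (f n (p n) - f n (q n)) ^ 2) U (𝓝 D) := by
    refine tendsto_of_tendsto_of_tendsto_of_le_of_le hlow4 tendsto_const_nhds
      (fun n => ?_) fun n => (hr n).trans (hrD n)
    have := (hI n).trans (hpq n)
    nlinarith [sq_nonneg (f n (p n) + f n (q n))]
  have hres : Filter.Tendsto (fun n => G.resistance (p n) (q n)) U (𝓝 D) :=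
    tendsto_of_tendsto_of_tendsto_of_le_of_le hdiff2 tendsto_const_nhds hr hrD
  have hrxy : G.resistance x y = D :=
    tendsto_nhds_unique (((G.continuous_resistance.tendsto (x, y)).comp
      (hx.prodMk_nhds hy))) hres
  have hdiff : Filter.Tendsto (fun n => f n (p n) - f n (q n)) U (𝓝 √D) := by
    refine hdiff2.sqrt.congr fun n => Real.sqrt_sq (sub_nonneg.2 (hqp n))
  have hsum : Filter.Tendsto (fun n => f n (p n) + f n (q n)) U (𝓝 0) := by
    have h1 := (hdiff2.sub (hprod.const_mul 4)).sqrt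
    rw [mul_div_cancel₀ D four_ne_zero, sub_self, Real.sqrt_zero] at h1
    refine (tendsto_zero_iff_abs_tendsto_zero _).2 (h1.congr fun n => ?_)
    rw [Function.comp_apply, ← Real.sqrt_sq_eq_abs]
    congr 1; ring
  -- Unit energy makes the sequence equicontinuous with modulus `√r`, so the moving extremal points
  -- may be replaced by their limits.
  have hosc : ∀ {u : ℕ → G.Point} {z : G.Point}, Filter.Tendsto u U (𝓝 z) →
      Filter.Tendsto (fun n => f n z - f n (u n)) U (𝓝 0) := by
    intro u z hu
    refine squeeze_zero_norm (a := fun n => √(G.resistance (u n) z)) (fun n => ?_) ?_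
    · have := abs_sub_le_sqrt_resistance_mul (hf n) z (u n)
      rwa [hE n, Real.sqrt_one, mul_one, G.resistance_comm] at this
    · have := ((G.continuous_sqrt_resistance_left z).tendsto z).comp hu
      rwa [resistance_self, Real.sqrt_zero] at this
  have hfx : Filter.Tendsto (fun n => f n x) U (𝓝 (√D / 2)) := by
    have h1 := (hosc hx).add ((hdiff.add hsum).div_const 2)
    rw [zero_add, add_zero] at h1
    exact h1.congr fun n => by ring
  have hfxy : Filter.Tendsto (fun n => f n x - f n y) U (𝓝 √D) := by
    have h1 := ((hosc hx).sub (hosc hy)).add hdiff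
    rw [sub_zero, zero_add] at h1
    exact h1.congr fun n => by ring
  obtain ⟨c, hc⟩ : ∃ c, c = (√D)⁻¹ := ⟨_, rfl⟩
  have hsD : 0 < √D := Real.sqrt_pos.2 hD
  have hcD : c * √D = 1 := hc ▸ inv_mul_cancel₀ hsD.ne'
  have hDs : √D * √D = D := Real.mul_self_sqrt hD.le
  -- The energy tends to `1 - 2 c √D + c² D = (1 - c √D)²`, which vanishes for `c = 1 / √D`.
  have hen : Filter.Tendsto (fun n => G.energy (f n - c • h) (f n - c • h)) U (𝓝 0) := by
    have h1 := ((hfxy.const_mul (2 * c)).const_sub 1).add_const (c ^ 2 * D)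
    have h2 : 1 - 2 * c * √D + c ^ 2 * D = 0 := by
      linear_combination (c * √D - 1) * hcD - c ^ 2 * hDs
    rw [h2] at h1
    exact h1.congr fun n => by rw [energy_sub_smul c (hf n) hh, hE n, hrxy]
  have hhx : h x = D := by rw [← hh.resistance_eq, hrxy]
  -- A uniform bound for `f n - F`: the deviation at `x` plus the oscillation allowed by the energy
  -- of `f n - c • h`.
  set η : ℕ → ℝ := fun n => √D * √(G.energy (f n - c • h) (f n - c • h)) + |f n x - √D / 2|
  have hη : Filter.Tendsto η U (𝓝 0) := by
    have h1 := (hen.sqrt.const_mul √D).add (hfx.sub_const (√D / 2)).abs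
    simpa using h1
  set F : G.Point → ℝ := fun z => c * (h z - D / 2) with hF
  have hFc : Continuous F := continuous_const.mul (hh.1.1.sub continuous_const)
  have hclose : ∀ n z, |f n z - F z| ≤ η n := by
    intro n z
    have h1 := abs_sub_le_sqrt_resistance_mul ((hf n).sub (hh.1.smul c)) z x
    have h2 : √(G.resistance z x) ≤ √D := Real.sqrt_le_sqrt (G.resistance_le_diam z x)
    have h3 := h1.trans (mul_le_mul_of_nonneg_right h2 (Real.sqrt_nonneg _))
    have h4 : f n z - F z = ((f n - c • h) z - (f n - c • h) x) + (f n x - √D / 2) := by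
      simp only [hF, Pi.sub_apply, Pi.smul_apply, smul_eq_mul, hhx]
      linear_combination c / 2 * hDs - (√D / 2) * hcD
    rw [h4]
    exact (abs_add_le _ _).trans (add_le_add h3 le_rfl)
  obtain ⟨C, hC⟩ := isCompact_univ.exists_bound_of_continuousOn hFc.continuousOn
  have hFi := integrable_of_continuous (μ := μ) hFc
  have hF0 : ∫ z, F z ∂μ = 0 := by
    have h1 : ∀ n, |∫ z, F z ∂μ| ≤ η n := by
      intro n
      have h2 : ∫ z, F z ∂μ = -∫ z, (f n z - F z) ∂μ := by
        rw [integral_sub (integrable_of_continuous (hf n).1) hFi, h0 n, zero_sub, neg_neg]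
      rw [h2, abs_neg]
      have := norm_integral_le_of_norm_le_const (μ := μ) (f := fun z => f n z - F z)
        (Filter.Eventually.of_forall (hclose n))
      simpa using this
    exact abs_nonpos_iff.1 (ge_of_tendsto' hη h1)
  have hF2 : D / 4 ≤ ∫ z, F z ^ 2 ∂μ := by
    have h1 : ∀ n : ℕ, 1 / (4 / D + 1 / ((n : ℝ) + 1)) ≤
        ∫ z, F z ^ 2 ∂μ + (2 * C * η n + η n ^ 2) := by
      intro n
      refine (hI n).trans ?_
      have h2 : ∫ z, F z ^ 2 ∂μ + (2 * C * η n + η n ^ 2)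
          = ∫ z, (F z ^ 2 + (2 * C * η n + η n ^ 2)) ∂μ := by
        rw [integral_add (integrable_of_continuous (f := fun z => F z ^ 2) (hFc.pow 2))
          (integrable_const _)]
        simp
      rw [h2]
      refine integral_mono (integrable_of_continuous ((hf n).1.pow 2))
        ((integrable_of_continuous (hFc.pow 2)).add (integrable_const _)) fun z => ?_
      have h3 := hclose n z
      have h4 : |F z| ≤ C := hC z (mem_univ z)
      have h5 : |F z| * |f n z - F z| ≤ C * η n :=
        mul_le_mul h4 h3 (abs_nonneg _) ((abs_nonneg _).trans h4)
      have h6 : |f n z - F z| ^ 2 ≤ η n ^ 2 := by gcongr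
      rw [← abs_mul] at h5
      rw [sq_abs] at h6
      have h7 := le_abs_self (F z * (f n z - F z))
      simp only
      nlinarith
    have h2 := ((hη.const_mul (2 * C)).add (hη.pow 2)).const_add (∫ z, F z ^ 2 ∂μ)
    have h3 := le_of_tendsto_of_tendsto' hlow h2 h1
    simpa using h3
  refine ⟨x, y, h, hh, hrxy, ?_, ?_⟩
  · rw [hF, integral_const_mul] at hF0
    exact (mul_eq_zero.1 hF0).resolve_left (hc ▸ inv_ne_zero hsD.ne')
  · simp only [hF, mul_pow] at hF2
    rw [integral_const_mul] at hF2
    have hc2 : c ^ 2 = 1 / D := by rw [hc, inv_pow, Real.sq_sqrt hD.le, one_div]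
    rw [hc2, one_div, ← div_eq_inv_mul, le_div_iff₀ hD] at hF2
    linarith

/-- Since `0 ≤ h ≤ D`, the variance `D² / 4` is the largest possible, and it forces `h * (D - h) =
0` almost everywhere. The values `D` and `0` occur only at `x` and `y`, and the mean `D / 2` makes
the two masses equal. -/
lemma eq_twoPointMeasure_of_potential (hD : 0 < G.resistanceDiam) {μ : Measure G.Point}
    [IsProbabilityMeasure μ] {x y : G.Point} {h : G.Point → ℝ} (hh : G.IsPotential x y h)
    (hxy : G.resistance x y = G.resistanceDiam)
    (h0 : ∫ z, (h z - G.resistanceDiam / 2) ∂μ = 0)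
    (h2 : G.resistanceDiam ^ 2 / 4 ≤ ∫ z, (h z - G.resistanceDiam / 2) ^ 2 ∂μ) :
    μ = G.twoPointMeasure x y := by
  set D := G.resistanceDiam with hDdef
  have hhx : h x = D := by rw [← hh.resistance_eq, hxy]
  have hE : G.energy h h = D := by rw [hh.energy_self, hhx]
  have hosc : ∀ u v, |h u - h v| ≤ D := by
    intro u v
    refine abs_le_of_sq_le_sq ?_ hD.le
    have h1 := sq_sub_le_resistance_mul_energy hh.1 u v
    rw [hE] at h1
    nlinarith [G.resistance_le_diam u v]
  have hrange : ∀ z, 0 ≤ h z ∧ h z ≤ D := by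
    intro z
    have h1 := (abs_le.1 (hosc x z)).2
    have h2 := (abs_le.1 (hosc z y)).2
    rw [hhx] at h1
    rw [hh.2.2] at h2
    constructor <;> linarith
  have hmax : ∀ z, h z = D → z = x := fun z hz => hh.eq_of_apply_eq_resistanceDiam hxy hD hz
  -- The reversed potential `D - h` attains its maximum `D` exactly where `h` vanishes.
  have hmin : ∀ z, h z = 0 → z = y := fun z hz =>
    hh.symm.eq_of_apply_eq_resistanceDiam (by rw [G.resistance_comm, hxy]) hD
      (by simp [hz, hhx, hDdef])
  have hcont := hh.1.1
  have hi := integrable_of_continuous (μ := μ) hcont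
  have hint : ∫ z, h z ∂μ = D / 2 := by
    rw [integral_sub hi (integrable_const _)] at h0
    simp at h0
    linarith
  have hae : ∀ᵐ z ∂μ, h z * (D - h z) = 0 := by
    have hc : Continuous fun z => h z * (D - h z) := hcont.mul (continuous_const.sub hcont)
    have hnn : ∀ z, 0 ≤ h z * (D - h z) := fun z =>
      mul_nonneg (hrange z).1 (sub_nonneg.2 (hrange z).2)
    have hle : ∫ z, h z * (D - h z) ∂μ ≤ 0 := by
      have : ∀ z, h z * (D - h z) = D ^ 2 / 4 - (h z - D / 2) ^ 2 := fun z => by ring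
      simp only [this]
      rw [integral_sub (integrable_const _)
        (integrable_of_continuous (f := fun z => (h z - D / 2) ^ 2)
          ((hcont.sub continuous_const).pow 2))]
      simpa using h2
    exact (integral_eq_zero_iff_of_nonneg hnn (integrable_of_continuous hc)).1
      (le_antisymm hle (integral_nonneg hnn))
  have hne : x ≠ y := by
    rintro rfl
    rw [resistance_self] at hxy
    exact hD.ne hxy
  -- The two atoms are measurable as level sets of the continuous function `h`.
  have hsx : {x} = h ⁻¹' {D} := by
    ext z; exact ⟨fun hz => by rw [mem_singleton_iff.1 hz]; exact hhx, fun hz => hmax z hz⟩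
  have hsy : {y} = h ⁻¹' {0} := by
    ext z; exact ⟨fun hz => by rw [mem_singleton_iff.1 hz]; exact hh.2.2, fun hz => hmin z hz⟩
  have hmx : MeasurableSet {x} := by
    rw [hsx]; exact (isClosed_singleton.preimage hcont).measurableSet
  have hmy : MeasurableSet {y} := by
    rw [hsy]; exact (isClosed_singleton.preimage hcont).measurableSet
  have hxy' : ∀ᵐ z ∂μ, z ∈ ({x}ᶜ : Set G.Point) ↔ z ∈ ({y} : Set G.Point) := by
    filter_upwards [hae] with z hz
    refine ⟨fun (hzx : z ≠ x) => ?_, fun hzy => ?_⟩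
    · rcases mul_eq_zero.1 hz with hz | hz
      · exact hmin z hz
      · exact absurd (hmax z (by linarith)) hzx
    · rw [mem_singleton_iff.1 hzy]; exact hne.symm
  have hreal : μ.real {x} = 1 / 2 := by
    have h3 : ∫ z, h z ∂μ = ∫ z, ({x} : Set G.Point).indicator (fun _ => D) z ∂μ := by
      refine integral_congr_ae ?_
      filter_upwards [hae] with z hz
      by_cases hzx : z = x
      · simp [hzx, hhx]
      · rw [indicator_of_notMem (by simpa using hzx)]
        rcases mul_eq_zero.1 hz with hz | hz
        · exact hz
        · exact absurd (hmax z (by linarith)) hzx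
    rw [integral_indicator_const _ hmx, hint, smul_eq_mul] at h3
    have : (μ.real {x} - 1 / 2) * D = 0 := by linarith
    linarith [(mul_eq_zero.1 this).resolve_right hD.ne']
  have hmux : μ {x} = 2⁻¹ := by
    rw [← ofReal_measureReal (measure_ne_top _ _), hreal, one_div,
      ENNReal.ofReal_inv_of_pos two_pos, ENNReal.ofReal_ofNat]
  have hmuy : μ {y} = 2⁻¹ := by
    rw [← measure_congr (Filter.eventuallyEq_set.2 hxy'), measure_compl hmx (measure_ne_top _ _), measure_univ, hmux,
      ENNReal.one_sub_inv_two]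
  rw [← Measure.restrict_add_restrict_compl (μ := μ) hmx, Measure.restrict_congr_set (Filter.eventuallyEq_set.2 hxy'),
    Measure.restrict_singleton, Measure.restrict_singleton, hmux, hmuy, twoPointMeasure, smul_add]

lemma eigenvalue_one_eq_optimal_iff (G : MetricGraph V E) (μ : Measure G.Point)
    [IsProbabilityMeasure μ] : G.eigenvalue 1 μ = G.optimalEigenvalue 1 ↔
      ∃ x y, G.resistance x y = G.resistanceDiam ∧ μ = G.twoPointMeasure x y := by
  rw [G.optimalEigenvalue_one]
  refine ⟨fun hμ => ?_, ?_⟩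
  · rcases G.resistanceDiam_nonneg.eq_or_lt with hD | hD
    -- On a single point there is only one probability measure.
    · have := subsingleton_point_of_resistanceDiam_eq_zero hD.symm
      obtain ⟨x, y, hxy⟩ := G.exists_resistance_eq_diam
      refine ⟨x, y, hxy, Measure.ext fun s _ => ?_⟩
      rcases s.eq_empty_or_nonempty with rfl | hs
      · simp
      · rw [Subsingleton.eq_univ_of_nonempty hs, measure_univ, measure_univ]
    · obtain ⟨x, y, h, hh, hxy, h0, h2⟩ := exists_potential_of_eigenvalue_eq hD μ hμ
      exact ⟨x, y, hxy, eq_twoPointMeasure_of_potential hD hh hxy h0 h2⟩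
  · rintro ⟨x, y, hxy, rfl⟩
    exact eigenvalue_one_twoPointMeasure hxy

end MetricGraph

namespace MetricGraph

variable {V E : Type*} {G : MetricGraph V E}

/-! ### Walks -/

lemma IsWalk.exists_of_mem {v w : V} {es : List E} (h : G.IsWalk v w es) (hes : es.Nodup) {e : E}
    (he : e ∈ es) {p : V} (hp : p = G.src e ∨ p = G.tgt e) :
    ∃ es', G.IsWalk p w es' ∧ es'.Nodup ∧ es' ⊆ es := by
  induction h with
  | nil => simp at he
  | @cons u v w es e' he' hw ih =>
    have hn := List.nodup_cons.1 hes
    rcases List.mem_cons.1 he with rfl | he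
    · have hpuv : p = u ∨ p = v := by
        rcases he' with ⟨h1, h2⟩ | ⟨h1, h2⟩ <;> rcases hp with rfl | rfl <;> simp [h1, h2]
      rcases hpuv with rfl | rfl
      · exact ⟨_, IsWalk.cons e he' hw, hes, List.Subset.refl _⟩
      · exact ⟨_, hw, hn.2, List.subset_cons_self _ _⟩
    · obtain ⟨es', h1, h2, h3⟩ := ih hn.2 he
      exact ⟨es', h1, h2, List.Subset.trans h3 (List.subset_cons_self _ _)⟩

/-- If `e` already occurs, prepending would repeat it; but then the walk visits `u`, and its tail
from there will do. -/
lemma IsWalk.exists_cons {u v w : V} {es : List E} (h : G.IsWalk v w es) (hes : es.Nodup) {e : E}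
    (he : (G.src e = u ∧ G.tgt e = v) ∨ (G.src e = v ∧ G.tgt e = u)) :
    ∃ es', G.IsWalk u w es' ∧ es'.Nodup ∧ es' ⊆ e :: es := by
  by_cases hm : e ∈ es
  · obtain ⟨es', h1, h2, h3⟩ := h.exists_of_mem hes hm (p := u)
      (by rcases he with ⟨h, -⟩ | ⟨-, h⟩ <;> simp [h])
    exact ⟨es', h1, h2, List.Subset.trans h3 (List.subset_cons_self _ _)⟩
  · exact ⟨_, IsWalk.cons e he h, List.nodup_cons.2 ⟨hm, hes⟩, List.Subset.refl _⟩

lemma exists_isWalk_nodup (G : MetricGraph V E) (u w : V) : ∃ es, G.IsWalk u w es ∧ es.Nodup := by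
  have key : ∀ a b, (∃ e, G.src e = a ∧ G.tgt e = b) →
      ((∃ es, G.IsWalk a w es ∧ es.Nodup) ↔ ∃ es, G.IsWalk b w es ∧ es.Nodup) := by
    rintro a b ⟨e, he⟩
    constructor
    · rintro ⟨es, h, hes⟩
      obtain ⟨es', h1, h2, -⟩ := h.exists_cons hes (Or.inr he)
      exact ⟨es', h1, h2⟩
    · rintro ⟨es, h, hes⟩
      obtain ⟨es', h1, h2, -⟩ := h.exists_cons hes (Or.inl he)
      exact ⟨es', h1, h2⟩
  have hall : ∀ a b, (∃ es, G.IsWalk a w es ∧ es.Nodup) ↔ ∃ es, G.IsWalk b w es ∧ es.Nodup := by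
    intro a b
    induction G.connected a b with
    | rel a b hab => exact key a b hab
    | refl a => rfl
    | symm a b _ ih => exact ih.symm
    | trans a b c _ _ h1 h2 => exact h1.trans h2
  exact (hall u w).2 ⟨[], IsWalk.nil w, List.nodup_nil⟩

/-- The vertex `v` is connected to the initial vertex of `e` by a walk that avoids `e`. -/
def SrcSide (G : MetricGraph V E) (e : E) (v : V) : Prop :=
  ∃ es, G.IsWalk v (G.src e) es ∧ es.Nodup ∧ e ∉ es

lemma srcSide_src (G : MetricGraph V E) (e : E) : G.SrcSide e (G.src e) :=
  ⟨[], IsWalk.nil _, List.nodup_nil, List.not_mem_nil⟩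

/-- Otherwise `e` would close the walk to a closed walk without repeated edges. -/
lemma IsTree.not_srcSide_tgt (hG : G.IsTree) (e : E) : ¬ G.SrcSide e (G.tgt e) := by
  rintro ⟨es, h, hes, he⟩
  have := hG _ _ (IsWalk.cons e (Or.inl ⟨rfl, rfl⟩) h) (List.nodup_cons.2 ⟨he, hes⟩)
  simp at this

/-- No other edge crosses the cut defined by `e`. Hence the projection to `e` is well defined and
constant on every other edge. -/
lemma srcSide_src_iff_tgt (G : MetricGraph V E) {e e' : E} (hne : e' ≠ e) :
    G.SrcSide e (G.src e') ↔ G.SrcSide e (G.tgt e') := by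
  constructor
  · rintro ⟨es, h, hes, he⟩
    obtain ⟨es', h1, h2, h3⟩ := h.exists_cons hes (e := e') (Or.inr ⟨rfl, rfl⟩)
    exact ⟨es', h1, h2, fun hm => by
      rcases List.mem_cons.1 (h3 hm) with h | h
      · exact hne h.symm
      · exact he h⟩
  · rintro ⟨es, h, hes, he⟩
    obtain ⟨es', h1, h2, h3⟩ := h.exists_cons hes (e := e') (Or.inl ⟨rfl, rfl⟩)
    exact ⟨es', h1, h2, fun hm => by
      rcases List.mem_cons.1 (h3 hm) with h | h
      · exact hne h.symm
      · exact he h⟩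

/-! ### The projections of a tree to its edges -/

open Classical in
/-- The position of the nearest point projection of a point of a tree to the edge `e`. -/
noncomputable def IsTree.proj (hG : G.IsTree) (e : E) : G.Point → ℝ :=
  Quot.lift (Sum.elim (fun v => if G.SrcSide e v then 0 else G.len e)
    fun p => if p.1 = e then p.2 else if G.SrcSide e (G.src p.1) then 0 else G.len e) (by
    rintro _ _ (e' | e')
    · by_cases h : e' = e
      · subst h; simp [G.srcSide_src e']
      · simp [h]
    · by_cases h : e' = e
      · subst h; simp [hG.not_srcSide_tgt e']
      · simp [h, G.srcSide_src_iff_tgt h])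

lemma IsTree.proj_vertex (hG : G.IsTree) (e : E) (v : V) :
    hG.proj e (G.vertex v) = 0 ∨ hG.proj e (G.vertex v) = G.len e := by
  classical
  change (if G.SrcSide e v then 0 else G.len e) = 0 ∨ (if G.SrcSide e v then 0 else G.len e) = _
  split_ifs <;> simp

lemma IsTree.proj_edgePoint_self (hG : G.IsTree) (e : E) (t : Icc (0 : ℝ) (G.len e)) :
    hG.proj e (G.edgePoint e t) = t := by
  classical
  change (if e = e then (t : ℝ) else _) = t
  rw [if_pos rfl]

lemma IsTree.proj_edgePoint_of_ne (hG : G.IsTree) {e e' : E} (h : e' ≠ e)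
    (t : Icc (0 : ℝ) (G.len e')) :
    hG.proj e (G.edgePoint e' t) = hG.proj e (G.vertex (G.src e')) := by
  classical
  change (if e' = e then (t : ℝ) else if G.SrcSide e (G.src e') then 0 else G.len e) =
    if G.SrcSide e (G.src e') then 0 else G.len e
  rw [if_neg h]

lemma IsTree.proj_mem (hG : G.IsTree) (e : E) (x : G.Point) : hG.proj e x ∈ Icc 0 (G.len e) := by
  have hv : ∀ v, hG.proj e (G.vertex v) ∈ Icc 0 (G.len e) := fun v => by
    rcases hG.proj_vertex e v with h | h <;> rw [h]
    · exact G.left_mem e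
    · exact G.right_mem e
  rcases G.point_cases x with ⟨v, rfl⟩ | ⟨e', t, rfl⟩
  · exact hv v
  · by_cases h : e' = e
    · subst h; rw [hG.proj_edgePoint_self]; exact t.2
    · rw [hG.proj_edgePoint_of_ne h]; exact hv _

/-- The nearest point projection to the edge `e` of a point that lies on another edge is an end
point of `e`. -/
lemma IsTree.exists_vertex_eq_proj (hG : G.IsTree) (e : E) {x : G.Point}
    (hx : hG.proj e x = 0 ∨ hG.proj e x = G.len e) :
    ∃ v, G.edgePoint e ⟨hG.proj e x, hG.proj_mem e x⟩ = G.vertex v := by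
  rcases hx with h | h
  · exact ⟨G.src e, by rw [← edgePoint_zero]; congr 2⟩
  · exact ⟨G.tgt e, by rw [← edgePoint_len]; congr 2⟩

/-! ### The distance of a tree -/

lemma HasPath.trans {x y z : G.Point} {c d : ℝ} (h : G.HasPath x y c) (h' : G.HasPath y z d) :
    G.HasPath x z (c + d) := by
  induction h with
  | nil => rwa [zero_add]
  | cons e s t _ ih => rw [add_assoc]; exact HasPath.cons e s t (ih h')

lemma HasPath.symm {x y : G.Point} {c : ℝ} (h : G.HasPath x y c) : G.HasPath y x c := by
  induction h with
  | nil => exact HasPath.nil _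
  | cons e s t _ ih =>
    have := ih.trans (HasPath.cons e t s (HasPath.nil _))
    rwa [add_zero, abs_sub_comm, add_comm] at this

section TreeDist

variable [Fintype E]

/-- The `ℓ¹` distance of the projections to the edges. -/
noncomputable def IsTree.treeDist (hG : G.IsTree) (x y : G.Point) : ℝ :=
  ∑ e, |hG.proj e x - hG.proj e y|

lemma IsTree.treeDist_comm (hG : G.IsTree) (x y : G.Point) :
    hG.treeDist x y = hG.treeDist y x := by
  simp only [treeDist, abs_sub_comm]

lemma IsTree.treeDist_self (hG : G.IsTree) (x : G.Point) : hG.treeDist x x = 0 := by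
  simp [treeDist]

lemma IsTree.treeDist_triangle (hG : G.IsTree) (x y z : G.Point) :
    hG.treeDist x z ≤ hG.treeDist x y + hG.treeDist y z := by
  simp only [treeDist]
  rw [← Finset.sum_add_distrib]
  exact Finset.sum_le_sum fun e _ => abs_sub_le _ _ _

/-- Sums over the edges of a quantity depending on the projections change along an edge only by the
summand of that edge. -/
lemma IsTree.sum_proj_sub (hG : G.IsTree) (F : E → ℝ → ℝ) (e : E) (s t : Icc (0 : ℝ) (G.len e)) :
    ∑ e', F e' (hG.proj e' (G.edgePoint e s)) - ∑ e', F e' (hG.proj e' (G.edgePoint e t)) =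
      F e s - F e t := by
  rw [← Finset.sum_sub_distrib, Finset.sum_eq_single e]
  · rw [hG.proj_edgePoint_self, hG.proj_edgePoint_self]
  · intro e' _ h
    rw [hG.proj_edgePoint_of_ne h.symm, hG.proj_edgePoint_of_ne h.symm, sub_self]
  · simp

lemma IsTree.treeDist_edgePoint (hG : G.IsTree) (e : E) (s t : Icc (0 : ℝ) (G.len e)) :
    hG.treeDist (G.edgePoint e s) (G.edgePoint e t) = |(s : ℝ) - t| := by
  have := hG.sum_proj_sub (fun e' p => |p - hG.proj e' (G.edgePoint e t)|) e s t
  simpa [treeDist, hG.proj_edgePoint_self] using this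

lemma IsTree.treeDist_le_of_hasPath (hG : G.IsTree) {x y : G.Point} {c : ℝ}
    (h : G.HasPath x y c) : hG.treeDist x y ≤ c := by
  induction h with
  | nil x => rw [hG.treeDist_self]
  | cons e s t _ ih =>
    exact (hG.treeDist_triangle _ (G.edgePoint e t) _).trans
      (add_le_add (hG.treeDist_edgePoint e s t).le ih)

/-- A path to the nearest point of an edge extends to a path to all points of that edge. -/
lemma IsTree.hasPath_edgePoint (hG : G.IsTree) {e : E} {s t : Icc (0 : ℝ) (G.len e)} {y : G.Point}
    (h : G.HasPath (G.edgePoint e t) y (hG.treeDist (G.edgePoint e t) y))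
    (hst : |(s : ℝ) - hG.proj e y| = |(s : ℝ) - t| + |t - hG.proj e y|) :
    G.HasPath (G.edgePoint e s) y (hG.treeDist (G.edgePoint e s) y) := by
  have h1 := hG.sum_proj_sub (fun e' p => |p - hG.proj e' y|) e s t
  have h2 : hG.treeDist (G.edgePoint e s) y = |(s : ℝ) - t| + hG.treeDist (G.edgePoint e t) y := by
    simp only [treeDist]
    linarith
  rw [h2]
  exact HasPath.cons e s t h

/-- Induction on the walk. The second clause says that unused edges do not separate the ends;
therefore, when `e` is prepended, the rest of the walk starts at the projection of `w` to `e`, and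
the length of `e` adds exactly. -/
lemma IsTree.hasPath_of_isWalk (hG : G.IsTree) {u w : V} {es : List E} (h : G.IsWalk u w es)
    (hes : es.Nodup) : G.HasPath (G.vertex u) (G.vertex w)
        (hG.treeDist (G.vertex u) (G.vertex w)) ∧
      ∀ e ∉ es, hG.proj e (G.vertex u) = hG.proj e (G.vertex w) := by
  induction h with
  | nil v => exact ⟨by rw [hG.treeDist_self]; exact HasPath.nil _, fun _ _ => rfl⟩
  | @cons u v w es e he hw ih =>
    have hn := List.nodup_cons.1 hes
    obtain ⟨ih1, ih2⟩ := ih hn.2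
    obtain ⟨s, t, hs, ht⟩ : ∃ s t : Icc (0 : ℝ) (G.len e),
        G.vertex u = G.edgePoint e s ∧ G.vertex v = G.edgePoint e t := by
      rcases he with ⟨rfl, rfl⟩ | ⟨rfl, rfl⟩
      · exact ⟨_, _, (G.edgePoint_zero e).symm, (G.edgePoint_len e).symm⟩
      · exact ⟨_, _, (G.edgePoint_len e).symm, (G.edgePoint_zero e).symm⟩
    have hp : hG.proj e (G.vertex w) = t := by
      rw [← ih2 e hn.1, ht, hG.proj_edgePoint_self]
    rw [ht] at ih1
    refine ⟨?_, fun e' he' => ?_⟩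
    · rw [hs]
      refine hG.hasPath_edgePoint ih1 ?_
      rw [hp, sub_self, abs_zero, add_zero]
    · rw [List.mem_cons, not_or] at he'
      rw [← ih2 e' he'.2, hs, ht, hG.proj_edgePoint_of_ne (Ne.symm he'.1),
        hG.proj_edgePoint_of_ne (Ne.symm he'.1)]

/-- From `x`, move inside its edge to the projection of `y`. This is `y` itself if both lie on that
edge, and otherwise an end point, so the problem reduces to walks between vertices. -/
lemma IsTree.hasPath_treeDist (hG : G.IsTree) (x y : G.Point) :
    G.HasPath x y (hG.treeDist x y) := by
  have hvv : ∀ u w, G.HasPath (G.vertex u) (G.vertex w) (hG.treeDist (G.vertex u) (G.vertex w)) :=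
    fun u w => by
      obtain ⟨es, h, hes⟩ := G.exists_isWalk_nodup u w
      exact (hG.hasPath_of_isWalk h hes).1
  have step : ∀ e s y, G.HasPath (G.edgePoint e ⟨hG.proj e y, hG.proj_mem e y⟩) y
      (hG.treeDist (G.edgePoint e ⟨hG.proj e y, hG.proj_mem e y⟩) y) →
      G.HasPath (G.edgePoint e s) y (hG.treeDist (G.edgePoint e s) y) := fun e s y h =>
    hG.hasPath_edgePoint h (by simp)
  have hev : ∀ e s u,
      G.HasPath (G.edgePoint e s) (G.vertex u) (hG.treeDist (G.edgePoint e s) (G.vertex u)) := by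
    intro e s u
    obtain ⟨v, hv⟩ := hG.exists_vertex_eq_proj e (hG.proj_vertex e u)
    refine step e s _ ?_
    rw [hv]
    exact hvv v u
  rcases G.point_cases y with ⟨w, rfl⟩ | ⟨e', t, rfl⟩
  · rcases G.point_cases x with ⟨u, rfl⟩ | ⟨e, s, rfl⟩
    · exact hvv u w
    · exact hev e s w
  · rcases G.point_cases x with ⟨u, rfl⟩ | ⟨e, s, rfl⟩
    · rw [hG.treeDist_comm]
      exact (hev e' t u).symm
    · refine step e s _ ?_
      by_cases h : e' = e
      · subst h
        have : G.edgePoint e' ⟨_, hG.proj_mem e' (G.edgePoint e' t)⟩ = G.edgePoint e' t := by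
          congr 1
          exact Subtype.ext (hG.proj_edgePoint_self e' t)
        rw [this, hG.treeDist_self]
        exact HasPath.nil _
      · obtain ⟨v, hv⟩ := hG.exists_vertex_eq_proj e (x := G.edgePoint e' t)
          (by rw [hG.proj_edgePoint_of_ne h]; exact hG.proj_vertex e _)
        rw [hv, hG.treeDist_comm]
        exact (hev e' t v).symm

lemma IsTree.pathDist_eq (hG : G.IsTree) (x y : G.Point) : G.pathDist x y = hG.treeDist x y :=
  IsLeast.csInf_eq ⟨hG.hasPath_treeDist x y, fun _ h => hG.treeDist_le_of_hasPath h⟩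

/-- Along an edge only the summand of that edge varies, and it varies like `g`. So `g` minus the sum
is constant on edges, hence constant by connectedness. -/
lemma IsTree.sub_eq_sum_proj (hG : G.IsTree) (g : G.Point → ℝ) (x y : G.Point) :
    g x - g y = ∑ e, (g (G.edgePoint e ⟨hG.proj e x, hG.proj_mem e x⟩) -
      g (G.edgePoint e ⟨hG.proj e y, hG.proj_mem e y⟩)) := by
  have h := G.eq_of_edgewise_eq
    (F := fun x => g x - ∑ e, g (G.edgePoint e ⟨hG.proj e x, hG.proj_mem e x⟩))
    (fun e s t => by
      have := hG.sum_proj_sub (fun e' p => G.onEdge g e' p) e s t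
      simp only [← G.onEdge_apply g]
      linarith) x y
  rw [Finset.sum_sub_distrib]
  linarith

/-- On each edge the derivative is plus or minus the indicator of the segment between the
projections of `x` and `y`: a unit flow. Its pairing with `g` is the sum in
`IsTree.sub_eq_sum_proj`. The second sum normalizes the value at `y`. -/
lemma IsTree.isPotential (hG : G.IsTree) (x y : G.Point) :
    G.IsPotential x y fun z => ∑ e, (min (hG.proj e z) (hG.proj e x) -
      min (hG.proj e z) (hG.proj e y)) -
      ∑ e, (min (hG.proj e y) (hG.proj e x) - min (hG.proj e y) (hG.proj e y)) := by
  set C := ∑ e, (min (hG.proj e y) (hG.proj e x) - min (hG.proj e y) (hG.proj e y))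
  set h : G.Point → ℝ := fun z => ∑ e, (min (hG.proj e z) (hG.proj e x) -
      min (hG.proj e z) (hG.proj e y)) - C with hh
  have hsub : ∀ e s t, h (G.edgePoint e s) - h (G.edgePoint e t) =
      (min (s : ℝ) (hG.proj e x) - min (s : ℝ) (hG.proj e y)) -
        (min (t : ℝ) (hG.proj e x) - min (t : ℝ) (hG.proj e y)) := by
    intro e s t
    have := hG.sum_proj_sub (fun e p => min p (hG.proj e x) - min p (hG.proj e y)) e s t
    simp only [hh]
    linarith
  have hint : ∀ a s t : ℝ, IntervalIntegrable (fun z => if z < a then (1 : ℝ) else 0) volume s t :=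
    fun a s t => (intervalIntegrable_const (c := (1 : ℝ))).mono_fun
      (measurable_ite_lt _).aestronglyMeasurable
      (Filter.Eventually.of_forall fun x => by dsimp only; split_ifs <;> simp)
  have hmem : ∀ a e, MemLp (fun z : ℝ => if z < a then (1 : ℝ) else 0) 2
      (volume.restrict (Ioo 0 (G.len e))) := fun a e =>
    MemLp.of_bound (measurable_ite_lt _).aestronglyMeasurable 1
      (Filter.Eventually.of_forall fun x => by split_ifs <;> simp)
  have hgrad : G.HasGrad h fun e z =>
      (if z < hG.proj e x then 1 else 0) - (if z < hG.proj e y then 1 else 0) := by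
    refine ⟨G.continuous_iff_edgewise.2 fun e => ?_, fun e => (hmem _ e).sub (hmem _ e),
      fun e s t => ?_⟩
    · have : (fun t => h (G.edgePoint e t)) = fun t : Icc (0 : ℝ) (G.len e) =>
          h (G.edgePoint e ⟨0, G.left_mem e⟩) + ((min (t : ℝ) (hG.proj e x) -
            min (t : ℝ) (hG.proj e y)) -
            (min (0 : ℝ) (hG.proj e x) - min (0 : ℝ) (hG.proj e y))) := by
        ext t
        rw [← hsub e t ⟨0, G.left_mem e⟩]
        ring
      rw [this]
      fun_prop
    · rw [hsub e t s, intervalIntegral.integral_sub (hint _ _ _) (hint _ _ _),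
        ← intervalIntegral.integral_interval_sub_left (hint _ 0 t) (hint _ 0 s),
        ← intervalIntegral.integral_interval_sub_left (hint _ 0 t) (hint _ 0 s),
        integral_ite_lt t.2.1 (hG.proj_mem e x).1, integral_ite_lt s.2.1 (hG.proj_mem e x).1,
        integral_ite_lt t.2.1 (hG.proj_mem e y).1, integral_ite_lt s.2.1 (hG.proj_mem e y).1]
      ring
  refine ⟨hgrad.memH1, fun g hg => ?_, sub_self _⟩
  rw [hgrad.energy_eq hg.hasGrad, hG.sub_eq_sum_proj g x y]
  refine Finset.sum_congr rfl fun e _ => ?_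
  have hi : IntegrableOn (G.grad g e) (Ioo 0 (G.len e)) :=
    (hg.hasGrad.memLp e).integrable (by norm_num)
  have hm : ∀ a : ℝ, IntegrableOn (fun z => (if z < a then 1 else 0) * G.grad g e z)
      (Ioo 0 (G.len e)) := fun a =>
    hi.bdd_mul (c := 1) (measurable_ite_lt _).aestronglyMeasurable
      (Filter.Eventually.of_forall fun x => by split_ifs <;> simp)
  have hk : ∀ z, ∫ x in Ioo 0 (G.len e), (if x < hG.proj e z then 1 else 0) * G.grad g e x =
      g (G.edgePoint e ⟨hG.proj e z, hG.proj_mem e z⟩) -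
        g (G.edgePoint e ⟨0, G.left_mem e⟩) := fun z => by
    rw [integral_Ioo_ite_lt_mul, min_eq_right (hG.proj_mem e z).2,
      ← intervalIntegral_eq_integral_Ioo (hG.proj_mem e z).1, hg.hasGrad.sub_eq]
  simp only [sub_mul]
  rw [integral_sub (hm _) (hm _), hk, hk]
  ring

lemma IsTree.resistance_eq_pathDist (hG : G.IsTree) (x y : G.Point) :
    G.resistance x y = G.pathDist x y := by
  rw [(hG.isPotential x y).resistance_eq, hG.pathDist_eq, treeDist, ← Finset.sum_sub_distrib]
  refine Finset.sum_congr rfl fun e _ => ?_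
  rw [min_self, min_self, min_comm (hG.proj e y)]
  rcases le_total (hG.proj e x) (hG.proj e y) with h | h
  · rw [min_eq_left h, abs_of_nonpos (by linarith)]; ring
  · rw [min_eq_right h, abs_of_nonneg (by linarith)]; ring

end TreeDist

end MetricGraph

theorem mainTheorem1 {V E : Type*} [Fintype V] [Fintype E] (G : MetricGraph V E) :
    -- the resistance attains its maximum, which is positive unless `G` is a single point
    IsGreatest (Set.range fun p : G.Point × G.Point => G.resistance p.1 p.2) G.resistanceDiam ∧
    (Nonempty E → 0 < G.resistanceDiam) ∧
    -- the first optimal eigenvalue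
    G.optimalEigenvalue 1 = 4 / ENNReal.ofReal G.resistanceDiam ∧
    -- the minimizing probability measures
    (∀ μ : MeasureTheory.Measure G.Point, MeasureTheory.IsProbabilityMeasure μ →
      (G.eigenvalue 1 μ = G.optimalEigenvalue 1 ↔
        ∃ x y : G.Point, G.resistance x y = G.resistanceDiam ∧ μ = G.twoPointMeasure x y)) ∧
    -- trees
    (G.IsTree →
      IsGreatest (Set.range fun p : G.Point × G.Point => G.pathDist p.1 p.2) G.pathDiam ∧
      G.optimalEigenvalue 1 = 4 / ENNReal.ofReal G.resistanceDiam ∧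
      G.optimalEigenvalue 1 = 4 / ENNReal.ofReal G.pathDiam) := by
  refine ⟨G.isGreatest_resistanceDiam, G.resistanceDiam_pos, G.optimalEigenvalue_one,
    fun μ _ => G.eigenvalue_one_eq_optimal_iff μ, fun hG => ?_⟩
  have h : (fun p : G.Point × G.Point => G.pathDist p.1 p.2) = fun p => G.resistance p.1 p.2 :=
    funext fun p => (hG.resistance_eq_pathDist p.1 p.2).symm
  have hd : G.pathDiam = G.resistanceDiam := by
    unfold MetricGraph.pathDiam MetricGraph.resistanceDiam
    rw [h]
  rw [h, hd]
  exact ⟨G.isGreatest_resistanceDiam, G.optimalEigenvalue_one, G.optimalEigenvalue_one⟩
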